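/- **Model.** For integers $N\ge 2$ and $M\ge 1$ write $I_N=\{0,1,\dots,N\}$, with boundary $\{0,N\}$ and interior $\{1,\dots,N-1\}$. For $z=(x,y)\in I_N\times I_M$, the $(N,M,z)$ model is the time-homogeneous Markov chain $\zeta_n=(X_n,\eta_n)$, $n\ge 0$, on $I_N\times I_M$ (location and energy) with $\zeta_0=z$ and the following transitions from a state $(x,i)$: * if $x$ is in the interior and $i\ge 1$, the chain moves to $(x-1,i-1)$ or $(x+1,i-1)$, each with probability $1/2$; * if $x$ is in the interior and $i=0$, the chain stays at $(x,0)$ forever; * if $x\in\{0,N\}$, the chain moves to $(x',M)$, where $x'$ is the unique interior neighbour of $x$ ($x'=1$ if $x=0$, and $x'=N-1$ if $x=N$). The total lifetime is $\lambda=\min\{n\ge 0: X_n\in\{1,\dots,N-1\},\ \eta_n=0\}$, with $\min\emptyset=\infty$. **Theorem.** For each $M\in\mathbb N=\{1,2,\dots\}$ let $N_M\ge 2$ be an integer and let $z_M=(x_M,y_M)\in I_{N_M}\times I_M$. Suppose that $$\lim_{M\to\infty}N_M=\infty,\qquad \lim_{M\to\infty}\frac{M}{N_M^2}=\infty,\qquad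 \liminf_{M\to\infty}\frac{y_M}{M}>0 .$$ Then, under the law of the $(N_M,M,z_M)$ model, $\lambda<\infty$ almost surely for all sufficiently large $M$, and, as $M\to\infty$, $$\frac{4\lambda}{N_M^2}\,\cos^M\!\left(\frac{\pi}{N_M}\right)\ \overset{d}{\longrightarrow}\ \mathcal E_1,$$ where $\mathcal E_1$ is an exponential random variable with mean $1$. No assumption is made on the initial locations $x_M\in I_{N_M}$, which do not affect the limit. -/

import Mathlib

open MeasureTheory ProbabilityTheory Filter

namespace EnergyWalk

/-- The state `(X, η)` of the walker: its location `X` and its current energy `η`. -/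
abbrev State : Type := ℕ × ℕ

/-- The interior `{1, …, N - 1}` of the interval `I_N = {0, …, N}`. -/
def IsInterior (N x : ℕ) : Prop := 0 < x ∧ x < N

instance (N x : ℕ) : Decidable (IsInterior N x) := inferInstanceAs (Decidable (_ ∧ _))

/-- The one-step transition law of the `(N, M)` model, from location `x` and energy `i`.
* In the interior with zero energy, the walker stays put forever (extinction).
* In the interior with positive energy, it makes a simple symmetric random walk step,
  which uses one unit of energy.
* At a boundary point `0` or `N`, it moves to the unique interior neighbour (`1` or `N - 1`)
  and its energy is replenished to the capacity `M`. -/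
noncomputable def step (N M : ℕ) : State → PMF State
  | (x, i) =>
    if IsInterior N x then
      match i with
      | 0 => PMF.pure (x, 0)
      | i + 1 => PMF.uniformOfFinset {(x - 1, i), (x + 1, i)} (Finset.insert_nonempty _ _)
    else PMF.pure (if x = 0 then 1 else N - 1, M)

/-- The transition law as a Markov kernel. -/
noncomputable def stepKernel (N M : ℕ) : Kernel State State :=
  Kernel.ofFunOfCountable fun s => (step N M s).toMeasure

instance (N M : ℕ) : IsMarkovKernel (stepKernel N M) :=
  ⟨fun s => inferInstanceAs (IsProbabilityMeasure (step N M s).toMeasure)⟩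

/-- The law of `ζ_{n+1}` given the history `(ζ_0, …, ζ_n)`: it depends on `ζ_n` only. -/
noncomputable def historyKernel (N M : ℕ) (n : ℕ) :
    Kernel ((i : Finset.Iic n) → (fun _ : ℕ => State) i) State :=
  (stepKernel N M).comap (fun h => h ⟨n, Finset.mem_Iic.2 le_rfl⟩) (measurable_pi_apply _)

instance (N M n : ℕ) : IsMarkovKernel (historyKernel N M n) :=
  inferInstanceAs (IsMarkovKernel ((stepKernel N M).comap _ _))

/-- The law of the finite-capacity `(N, M, z)` model: the law, on the space of trajectories
`ζ = (ζ_0, ζ_1, …)`, of the Markov chain with initial state `z` and transition law `step N M`. -/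
noncomputable def law (N M : ℕ) (z : State) : Measure (ℕ → State) :=
  Kernel.traj (X := fun _ => State) (historyKernel N M) 0 (fun _ => z)

instance (N M : ℕ) (z : State) : IsProbabilityMeasure (law N M z) :=
  inferInstanceAs (IsProbabilityMeasure
    (Kernel.traj (X := fun _ => State) (historyKernel N M) 0 (fun _ => z)))

/-- The total lifetime: the first time at which the walker is in the interior with zero energy,
with value `⊤` (that is, `∞`) if there is no such time. -/
noncomputable def lifetime (N : ℕ) (ζ : ℕ → State) : ℕ∞ :=
  ⨅ (n : ℕ) (_ : IsInterior N (ζ n).1 ∧ (ζ n).2 = 0), (n : ℕ∞)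

/-- The exponential distribution with mean `1` is a probability measure. -/
instance isProbabilityMeasure_expMeasure_one : IsProbabilityMeasure (expMeasure 1) :=
  isProbabilityMeasure_expMeasure one_pos

end EnergyWalk

/-!
The walker makes excursions from the boundary, each started at an interior neighbour of the boundary
with full energy `M`, until an excursion is too long for its energy. With `T` the exit time of the
simple random walk from the interior `{1, …, N - 1}` and `p = P₁(T > M)`, an excursion is fatal with
probability `p` and lasts about `N` steps on average, so that the lifetime should be about `N` times
a geometric variable of parameter `p`, with `p` equivalent to `(4 / N) cos (π / N) ^ M`.

The proof makes this exact with generating functions. For `|r| ≤ 1` the function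
`lifetimeGen N M r`, built from the survival probabilities `P_x(T > n)` and the solution of a scalar
renewal equation, equals `1` at the absorbing states and is multiplied by `1 / r` under the
transition operator elsewhere; optional stopping of the martingale `stopped` identifies it with the
generating function `E[r ^ λ]` of the lifetime `λ`, in `integral_pow_lifetime`. Letting `r` increase
to `1` shows that `λ` is almost surely finite (`lifetime_ne_top`); putting `r = exp (i t ε)` with
`ε = 4 cos (π / N) ^ M / N ^ 2` gives the characteristic function of the scaled lifetime, and
Lévy's continuity theorem reduces the claim to the limit `1 / (1 - i t)` (`tendsto_lifetimeGen`).

Two facts on the simple random walk are used. Comparison with the function `x (N - x)` gives the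
mean of the truncated exit time and Markov's inequality (`sum_survival_le`, `le_sum_survival`); in
particular the initial energy, of order `M`, which is much larger than `N ^ 2`, suffices to reach
the boundary with high probability. The spectral formula `survival_one_eq_sum`, where the principal
eigenvalue `cos (π / N)` dominates (`abs_survival_sub_le`), gives the equivalent of `p`
(`tendsto_survival_div_cos_pow`).
-/

namespace EnergyWalk

/-! ### The exit time of the simple random walk -/

/-- The probability that a simple symmetric random walk started at `x` spends the times `0, …, n`
in the interior of `{0, …, N}`, defined by its first-step recursion. -/
noncomputable def survival (N : ℕ) : ℕ → ℕ → ℝ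
  | 0, x => if IsInterior N x then 1 else 0
  | n + 1, x => if IsInterior N x then (survival N n (x - 1) + survival N n (x + 1)) / 2 else 0

lemma survival_of_not_isInterior {N x : ℕ} (hx : ¬ IsInterior N x) (n : ℕ) :
    survival N n x = 0 := by
  cases n <;> simp [survival, hx]

lemma survival_zero {N x : ℕ} (hx : IsInterior N x) : survival N 0 x = 1 := by
  simp [survival, hx]

lemma survival_succ {N x : ℕ} (hx : IsInterior N x) (n : ℕ) :
    survival N (n + 1) x = (survival N n (x - 1) + survival N n (x + 1)) / 2 := by
  simp [survival, hx]

lemma survival_nonneg (N n x : ℕ) : 0 ≤ survival N n x := by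
  induction n generalizing x with
  | zero => rw [survival]; split_ifs <;> norm_num
  | succ n ih => rw [survival]; split_ifs <;> linarith [ih (x - 1), ih (x + 1)]

lemma survival_le_one (N n x : ℕ) : survival N n x ≤ 1 := by
  induction n generalizing x with
  | zero => rw [survival]; split_ifs <;> norm_num
  | succ n ih => rw [survival]; split_ifs <;> linarith [ih (x - 1), ih (x + 1)]

lemma survival_succ_le (N n x : ℕ) : survival N (n + 1) x ≤ survival N n x := by
  by_cases hx : IsInterior N x
  swap
  · simp [survival_of_not_isInterior hx]
  induction n generalizing x with
  | zero => rw [survival_zero hx]; exact survival_le_one _ _ _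
  | succ n ih =>
    have key : ∀ y, survival N (n + 1) y ≤ survival N n y := fun y => by
      by_cases hy : IsInterior N y
      · exact ih y hy
      · simp [survival_of_not_isInterior hy]
    rw [survival_succ hx, survival_succ hx n]
    linarith [key (x - 1), key (x + 1)]

lemma survival_antitone (N x : ℕ) : Antitone fun n => survival N n x :=
  antitone_nat_of_succ_le fun n => survival_succ_le N n x

lemma survival_reflect (N n x : ℕ) (hx : x ≤ N) : survival N n (N - x) = survival N n x := by
  have hi : IsInterior N (N - x) ↔ IsInterior N x := by unfold IsInterior; omega
  induction n generalizing x with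
  | zero => simp [survival, hi]
  | succ n ih =>
    by_cases h : IsInterior N x
    · obtain ⟨h0, h1⟩ := h
      rw [survival_succ (hi.2 ⟨h0, h1⟩), survival_succ ⟨h0, h1⟩,
        show N - x - 1 = N - (x + 1) by omega, show N - x + 1 = N - (x - 1) by omega,
        ih (x + 1) (by omega) (by unfold IsInterior; omega),
        ih (x - 1) (by omega) (by unfold IsInterior; omega), add_comm]
    · rw [survival_of_not_isInterior h, survival_of_not_isInterior (mt hi.1 h)]

lemma sum_survival_succ {N x : ℕ} (hx : IsInterior N x) (n : ℕ) :
    ∑ k ∈ Finset.range (n + 1), survival N k x =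
      1 + ((∑ k ∈ Finset.range n, survival N k (x - 1)) +
        ∑ k ∈ Finset.range n, survival N k (x + 1)) / 2 := by
  rw [Finset.sum_range_succ', survival_zero hx, ← Finset.sum_add_distrib, Finset.sum_div,
    add_comm]
  simp only [survival_succ hx]

/-- The truncated mean exit time from `x` is at most the mean exit time `x (N - x)`. -/
lemma sum_survival_le {N x : ℕ} (hx : x ≤ N) (n : ℕ) :
    ∑ k ∈ Finset.range n, survival N k x ≤ (x : ℝ) * (N - x) := by
  have hxR : (x : ℝ) ≤ N := by exact_mod_cast hx
  induction n generalizing x with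
  | zero => simpa using mul_nonneg (Nat.cast_nonneg x) (sub_nonneg.2 hxR)
  | succ n ih =>
    by_cases h : IsInterior N x
    · obtain ⟨h0, h1⟩ := h
      obtain ⟨m, rfl⟩ : ∃ m, x = m + 1 := ⟨x - 1, by omega⟩
      rw [sum_survival_succ ⟨h0, h1⟩]
      have h3 := @ih (m + 1 - 1) (by omega) (by norm_cast; omega)
      have h4 := @ih (m + 1 + 1) (by omega) (by norm_cast)
      simp only [Nat.add_sub_cancel] at h3 ⊢
      push_cast at h3 h4 ⊢
      linarith
    · simpa [survival_of_not_isInterior h] using mul_nonneg (Nat.cast_nonneg x) (sub_nonneg.2 hxR)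

/-- The mean of the part of the exit time after time `n` is at most `N² / 4`, the maximal mean exit
time, times the probability of surviving until `n`. -/
lemma le_sum_survival {N x : ℕ} (hx : x ≤ N) (n : ℕ) :
    (x : ℝ) * (N - x) - N ^ 2 / 4 * survival N n x ≤ ∑ k ∈ Finset.range n, survival N k x := by
  have hb : ∀ y ≤ N, ¬ IsInterior N y → (y : ℝ) * (N - y) = 0 := by
    intro y hy h
    have : y = 0 ∨ y = N := by unfold IsInterior at h; omega
    rcases this with rfl | rfl <;> simp
  induction n generalizing x with
  | zero =>
    by_cases h : IsInterior N x
    · rw [survival_zero h]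
      simp only [Finset.range_zero, Finset.sum_empty]
      nlinarith [sq_nonneg ((x : ℝ) - N / 2)]
    · simp [hb x hx h, survival_of_not_isInterior h]
  | succ n ih =>
    by_cases h : IsInterior N x
    · obtain ⟨h0, h1⟩ := h
      obtain ⟨m, rfl⟩ : ∃ m, x = m + 1 := ⟨x - 1, by omega⟩
      rw [sum_survival_succ ⟨h0, h1⟩, survival_succ ⟨h0, h1⟩]
      have h3 := @ih (m + 1 - 1) (by omega)
      have h4 := @ih (m + 1 + 1) (by omega)
      simp only [Nat.add_sub_cancel] at h3 ⊢
      push_cast at h3 h4 ⊢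
      linarith
    · simp [hb x hx h, survival_of_not_isInterior h]

/-- Markov's inequality for the exit time. -/
lemma survival_mul_le {N x : ℕ} (hx : x ≤ N) (n : ℕ) : n * survival N n x ≤ (x : ℝ) * (N - x) := by
  have h1 : (n : ℝ) * survival N n x ≤ ∑ k ∈ Finset.range n, survival N k x := by
    have := Finset.card_nsmul_le_sum (Finset.range n) (fun k => survival N k x) (survival N n x)
      fun k hk => survival_antitone N x (Finset.mem_range.1 hk).le
    simpa using this
  exact h1.trans (sum_survival_le hx n)

/-! ### Spectral formula for the exit time -/

/-- The odd multiple `(2l + 1)π / N` of `π / N`. For `l < N`, the numbers `cos (oddAngle N l)`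
are the eigenvalues of the killed walk with symmetric eigenvectors, counted twice, together with
the value `-1` if `N` is odd, whose weight in the spectral formula vanishes. -/
noncomputable def oddAngle (N l : ℕ) : ℝ := (2 * l + 1) * Real.pi / N

lemma oddAngle_mul {N : ℕ} (hN : 0 < N) (l : ℕ) : N * oddAngle N l = (2 * l + 1) * Real.pi := by
  unfold oddAngle; field_simp

lemma sum_cos_mul_oddAngle {N x : ℕ} (h0 : 0 < x) (hx : x < N) :
    ∑ l ∈ Finset.range N, Real.cos (x * oddAngle N l) = 0 := by
  have hNR : (0 : ℝ) < N := by exact_mod_cast h0.trans hx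
  have hx0 : (0 : ℝ) < x := by exact_mod_cast h0
  have hxN : (x : ℝ) < N := by exact_mod_cast hx
  set β : ℝ := x * Real.pi / N with hβ
  have hs : Real.sin β ≠ 0 := by
    refine (Real.sin_pos_of_pos_of_lt_pi (by positivity) ?_).ne'
    rw [hβ, div_lt_iff₀ hNR]
    nlinarith [Real.pi_pos]
  have key : ∀ n : ℕ, (∑ l ∈ Finset.range n, Real.cos (x * oddAngle N l)) * (2 * Real.sin β) =
      Real.sin (2 * n * β) := by
    intro n
    induction n with
    | zero => simp
    | succ n ih =>
      rw [Finset.sum_range_succ, add_mul, ih]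
      have e1 : (x : ℝ) * oddAngle N n = 2 * n * β + β := by
        rw [hβ, oddAngle]; field_simp
      have e2 : 2 * ((n + 1 : ℕ) : ℝ) * β = (2 * n * β + β) + β := by push_cast; ring
      have e3 : Real.sin (2 * n * β) = Real.sin ((2 * n * β + β) - β) := by ring_nf
      rw [e1, e2, e3, Real.sin_add, Real.sin_sub]
      ring
  have h1 := key N
  have e : 2 * (N : ℝ) * β = ((2 * x : ℕ) : ℝ) * Real.pi := by
    rw [hβ]; field_simp; push_cast; ring
  rw [e, Real.sin_nat_mul_pi] at h1
  have h2 : (2 * Real.sin β) ≠ 0 := by positivity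
  exact (mul_eq_zero.1 h1).resolve_right h2

lemma sin_half_oddAngle_pos {N l : ℕ} (hl : l < N) : 0 < Real.sin (oddAngle N l / 2) := by
  have hNR : (0 : ℝ) < N := by exact_mod_cast (Nat.zero_le l).trans_lt hl
  have hlR : (l : ℝ) + 1 ≤ N := by exact_mod_cast hl
  apply Real.sin_pos_of_pos_of_lt_pi
  · unfold oddAngle; positivity
  · rw [oddAngle, div_div, div_lt_iff₀ (by positivity)]
    nlinarith [Real.pi_pos]

lemma sin_mul_cot_half {b : ℝ} (hb : Real.sin (b / 2) ≠ 0) :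
    Real.sin b * (Real.cos (b / 2) / Real.sin (b / 2)) = 1 + Real.cos b := by
  have h1 : Real.sin b = 2 * Real.sin (b / 2) * Real.cos (b / 2) := by
    rw [← Real.sin_two_mul]; ring_nf
  have h2 : Real.cos b = 2 * Real.cos (b / 2) ^ 2 - 1 := by
    rw [← Real.cos_two_mul]; ring_nf
  rw [h1, h2]
  field_simp
  ring

lemma sin_succ_mul_cot_half {b : ℝ} (hb : Real.sin (b / 2) ≠ 0) (x : ℝ) :
    Real.sin ((x + 1) * b) * (Real.cos (b / 2) / Real.sin (b / 2)) =
      Real.sin (x * b) * (Real.cos (b / 2) / Real.sin (b / 2)) +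
        (Real.cos (x * b) + Real.cos ((x + 1) * b)) := by
  have e0 : x * b = (x + 1 / 2) * b - b / 2 := by ring
  have e1 : (x + 1) * b = (x + 1 / 2) * b + b / 2 := by ring
  rw [e0, e1, Real.sin_add, Real.sin_sub, Real.cos_add, Real.cos_sub]
  field_simp
  ring

/-- The indicator of the interior, expanded in eigenvectors of the killed walk. -/
lemma sum_sin_mul_cot {N x : ℕ} (h0 : 0 < x) (hx : x < N) :
    ∑ l ∈ Finset.range N, Real.sin (x * oddAngle N l) *
      (Real.cos (oddAngle N l / 2) / Real.sin (oddAngle N l / 2)) = N := by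
  induction x, h0 using Nat.le_induction with
  | base =>
    have h := sum_cos_mul_oddAngle one_pos hx
    rw [Finset.sum_congr rfl (g := fun l => 1 + Real.cos (((1 : ℕ) : ℝ) * oddAngle N l)),
      Finset.sum_add_distrib, h]
    · simp
    · intro l hl
      simpa using sin_mul_cot_half (sin_half_oddAngle_pos (Finset.mem_range.1 hl)).ne'
  | succ x h0 ih =>
    have e := ih (by omega)
    have h1 := sum_cos_mul_oddAngle (N := N) (x := x) h0 (by omega)
    have h2 := sum_cos_mul_oddAngle (N := N) (x := x + 1) (by omega) hx
    push_cast at h2 ⊢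
    rw [Finset.sum_congr rfl fun l hl => sin_succ_mul_cot_half
      (sin_half_oddAngle_pos (Finset.mem_range.1 hl)).ne' (x : ℝ), Finset.sum_add_distrib,
      Finset.sum_add_distrib, h1, h2, e]
    ring

lemma survival_eq_sum {N x : ℕ} (hN : 0 < N) (hx : x ≤ N) (n : ℕ) :
    N * survival N n x = ∑ l ∈ Finset.range N, Real.cos (oddAngle N l) ^ n *
      (Real.sin (x * oddAngle N l) *
        (Real.cos (oddAngle N l / 2) / Real.sin (oddAngle N l / 2))) := by
  have hbd : ∀ n, ∀ y ≤ N, ¬ IsInterior N y → N * survival N n y =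
      ∑ l ∈ Finset.range N, Real.cos (oddAngle N l) ^ n * (Real.sin (y * oddAngle N l) *
        (Real.cos (oddAngle N l / 2) / Real.sin (oddAngle N l / 2))) := by
    intro n y hy h
    rw [survival_of_not_isInterior h, mul_zero, Finset.sum_eq_zero]
    intro l _
    have : y = 0 ∨ y = N := by unfold IsInterior at h; omega
    rcases this with rfl | rfl
    · simp
    · have h3 : Real.sin (y * oddAngle y l) = 0 := by
        rw [oddAngle_mul hN]
        exact_mod_cast Real.sin_nat_mul_pi (2 * l + 1)
      simp [h3]
  induction n generalizing x with
  | zero =>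
    by_cases h : IsInterior N x
    · simp [survival_zero h, sum_sin_mul_cot h.1 h.2]
    · exact hbd 0 x hx h
  | succ n ih =>
    by_cases h : IsInterior N x
    swap
    · exact hbd (n + 1) x hx h
    obtain ⟨h0, h1⟩ := h
    obtain ⟨m, rfl⟩ : ∃ m, x = m + 1 := ⟨x - 1, by omega⟩
    have h3 := @ih m (by omega)
    have h4 := @ih (m + 2) (by omega)
    rw [survival_succ ⟨h0, h1⟩, Nat.add_sub_cancel, mul_div_assoc', mul_add, h3, h4,
      ← Finset.sum_add_distrib, Finset.sum_div]
    refine Finset.sum_congr rfl fun l _ => ?_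
    set b := oddAngle N l
    have e0 : ((m : ℕ) : ℝ) * b = ((m + 1 : ℕ) : ℝ) * b - b := by push_cast; ring
    have e1 : ((m + 2 : ℕ) : ℝ) * b = ((m + 1 : ℕ) : ℝ) * b + b := by push_cast; ring
    rw [e0, e1, Real.sin_add, Real.sin_sub]
    ring

/-- Spectral formula for the exit time of the walk started next to the boundary. -/
lemma survival_one_eq_sum {N : ℕ} (hN : 0 < N) (n : ℕ) :
    N * survival N n 1 = ∑ l ∈ Finset.range N, Real.cos (oddAngle N l) ^ n *
      (1 + Real.cos (oddAngle N l)) := by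
  rw [survival_eq_sum hN hN]
  refine Finset.sum_congr rfl fun l hl => ?_
  rw [Nat.cast_one, one_mul, sin_mul_cot_half (sin_half_oddAngle_pos (Finset.mem_range.1 hl)).ne']

/-! ### Dominance of the principal eigenvalue -/

lemma oddAngle_zero (N : ℕ) : oddAngle N 0 = Real.pi / N := by simp [oddAngle]

lemma cos_oddAngle_pred {N : ℕ} (hN : 0 < N) :
    Real.cos (oddAngle N (N - 1)) = Real.cos (Real.pi / N) := by
  have hNR : (N : ℝ) ≠ 0 := by positivity
  have : oddAngle N (N - 1) = 2 * Real.pi - Real.pi / N := by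
    rw [oddAngle, Nat.cast_pred hN]; field_simp; ring
  rw [this, Real.cos_two_pi_sub]

lemma cos_pi_div_pos {N : ℕ} (hN : 3 ≤ N) : 0 < Real.cos (Real.pi / N) := by
  have hNR : (3 : ℝ) ≤ N := by exact_mod_cast hN
  apply Real.cos_pos_of_mem_Ioo
  constructor
  · linarith [Real.pi_pos, div_nonneg Real.pi_pos.le (by linarith : (0 : ℝ) ≤ N)]
  · exact div_lt_div_of_pos_left Real.pi_pos (by norm_num) (by linarith)

lemma cos_eq_neg_cos_abs_sub_pi (b : ℝ) : Real.cos b = -Real.cos |b - Real.pi| := by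
  rw [Real.cos_abs, Real.cos_sub_pi, neg_neg]

lemma cos_oddAngle_le {N l : ℕ} (h1 : 1 ≤ l) (h2 : l + 1 < N) :
    Real.cos (oddAngle N l) ≤ Real.cos (Real.pi / N) ^ 2 := by
  have hNR : (0 : ℝ) < N := by exact_mod_cast (Nat.zero_le _).trans_lt h2
  have h1R : (1 : ℝ) ≤ l := by exact_mod_cast h1
  have h2R : (l : ℝ) + 2 ≤ N := by exact_mod_cast h2
  have hpi := Real.pi_pos
  have h : |oddAngle N l - Real.pi| ≤ Real.pi - 2 * (Real.pi / N) := by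
    rw [abs_le, oddAngle]
    constructor
    · have : 0 ≤ (2 * l + 1 - 2) * Real.pi / N := by
        apply div_nonneg _ hNR.le; nlinarith
      have e : (2 * (l : ℝ) + 1 - 2) * Real.pi / N =
        (2 * l + 1) * Real.pi / N - 2 * (Real.pi / N) := by ring
      linarith
    · have : 0 ≤ (2 * N - 2 - (2 * l + 1)) * Real.pi / N := by
        apply div_nonneg _ hNR.le; nlinarith
      have e : (2 * (N : ℝ) - 2 - (2 * l + 1)) * Real.pi / N =
        2 * Real.pi - 2 * (Real.pi / N) - (2 * l + 1) * Real.pi / N := by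
        field_simp
      linarith
  have hle : 0 ≤ 2 * (Real.pi / N) := by positivity
  have := Real.cos_le_cos_of_nonneg_of_le_pi (abs_nonneg _) (by linarith) h
  rw [Real.cos_pi_sub, Real.cos_two_mul] at this
  rw [cos_eq_neg_cos_abs_sub_pi]
  nlinarith [Real.cos_sq_le_one (Real.pi / N)]

lemma neg_cos_oddAngle_le {N l : ℕ} (hl : l < N) (h : Real.cos (oddAngle N l) ≠ -1) :
    -Real.cos (oddAngle N l) ≤ Real.cos (Real.pi / N) := by
  have hNR : (0 : ℝ) < N := by exact_mod_cast (Nat.zero_le _).trans_lt hl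
  have hlR : (l : ℝ) + 1 ≤ N := by exact_mod_cast hl
  have hl0 : (0 : ℝ) ≤ l := Nat.cast_nonneg l
  have hpi := Real.pi_pos
  -- The distance from `oddAngle N l` to `π` is a nonzero multiple of `π / N`.
  have e : oddAngle N l - Real.pi = (2 * l + 1 - N) * (Real.pi / N) := by
    rw [oddAngle]; field_simp
  have hne : 2 * l + 1 ≠ N := by
    intro h'
    apply h
    have : oddAngle N l = Real.pi := by
      have : (2 * (l : ℝ) + 1) = N := by exact_mod_cast h'
      rw [oddAngle, this]; field_simp
    rw [this, Real.cos_pi]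
  have habs : (1 : ℝ) ≤ |2 * (l : ℝ) + 1 - N| := by
    have : (1 : ℤ) ≤ |2 * (l : ℤ) + 1 - N| := Int.one_le_abs (by omega)
    exact_mod_cast this
  have hq : 0 < Real.pi / N := by positivity
  rw [cos_eq_neg_cos_abs_sub_pi, neg_neg, e, abs_mul, abs_of_pos hq]
  apply Real.cos_le_cos_of_nonneg_of_le_pi hq.le
  · have : |2 * (l : ℝ) + 1 - N| ≤ N := by rw [abs_le]; constructor <;> linarith
    calc _ ≤ N * (Real.pi / N) := by gcongr
      _ = Real.pi := by field_simp
  · nlinarith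

lemma pow_mul_one_sub_le {s : ℝ} (h0 : 0 ≤ s) (h1 : s ≤ 1) (m : ℕ) :
    s ^ m * (1 - s) ≤ 1 / (m + 1) := by
  rw [le_div_iff₀ (by positivity)]
  have hg : (∑ k ∈ Finset.range (m + 1), s ^ k) * (1 - s) = 1 - s ^ (m + 1) := by
    linarith [geom_sum_mul s (m + 1)]
  have hs : (m + 1 : ℝ) * s ^ m ≤ ∑ k ∈ Finset.range (m + 1), s ^ k := by
    have := Finset.card_nsmul_le_sum (Finset.range (m + 1)) (fun k => s ^ k) (s ^ m)
      fun k hk => pow_le_pow_of_le_one h0 h1 (Nat.lt_succ_iff.1 (Finset.mem_range.1 hk))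
    simpa using this
  have := mul_le_mul_of_nonneg_right hs (sub_nonneg.2 h1)
  nlinarith [pow_nonneg h0 (m + 1)]

/-- A non-principal term of the spectral formula. Negative eigenvalues may have the same modulus
as the principal one, but `1 + cos b` is then small, and `s ^ m * (1 - s) ≤ 1 / (m + 1)` takes
advantage of it; positive ones are at most the square of the principal eigenvalue. -/
lemma abs_term_le {N M l : ℕ} (h1 : 1 ≤ l) (h2 : l + 1 < N) (hM : 2 * N ^ 2 ≤ M) :
    |Real.cos (oddAngle N l) ^ M * (1 + Real.cos (oddAngle N l))| ≤
      Real.cos (Real.pi / N) ^ (M - N ^ 2) / (N ^ 2 + 1) +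
        (Real.cos (Real.pi / N) ^ 2) ^ (M - 2 * N ^ 2) *
          (Real.cos (oddAngle N l) ^ (2 * N ^ 2) * (1 + Real.cos (oddAngle N l))) := by
  have hc := cos_pi_div_pos (N := N) (by omega)
  have hA := cos_oddAngle_le h1 h2
  have hB := neg_cos_oddAngle_le (N := N) (l := l) (by omega)
  set c := Real.cos (Real.pi / N)
  set s := Real.cos (oddAngle N l) with hs
  have hs1 : 0 ≤ 1 + s := by linarith [Real.neg_one_le_cos (oddAngle N l)]
  have hfirst : 0 ≤ c ^ (M - N ^ 2) / ((N : ℝ) ^ 2 + 1) := by positivity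
  have hsecond : 0 ≤ (c ^ 2) ^ (M - 2 * N ^ 2) * (s ^ (2 * N ^ 2) * (1 + s)) := by
    have : 0 ≤ s ^ (2 * N ^ 2) := by rw [pow_mul]; positivity
    positivity
  rw [abs_mul, abs_pow, abs_of_nonneg hs1]
  rcases le_total 0 s with h0 | h0
  · rw [abs_of_nonneg h0]
    have e : s ^ M = s ^ (M - 2 * N ^ 2) * s ^ (2 * N ^ 2) := by
      rw [← pow_add]; congr 1; omega
    rw [e, mul_assoc]
    have : s ^ (M - 2 * N ^ 2) ≤ (c ^ 2) ^ (M - 2 * N ^ 2) := pow_le_pow_left₀ h0 hA _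
    have := mul_le_mul_of_nonneg_right this (by positivity : 0 ≤ s ^ (2 * N ^ 2) * (1 + s))
    linarith
  · rw [abs_of_nonpos h0]
    -- The eigenvalue `-1` has weight zero.
    by_cases h : s = -1
    · rw [h] at hsecond ⊢
      simpa using add_nonneg hfirst hsecond
    have h3 := hB h
    have e : (-s) ^ M = (-s) ^ (M - N ^ 2) * (-s) ^ (N ^ 2) := by
      rw [← pow_add]; congr 1; omega
    have h4 := pow_mul_one_sub_le (neg_nonneg.2 h0) (by linarith) (N ^ 2)
    have h5 : (-s) ^ (M - N ^ 2) ≤ c ^ (M - N ^ 2) := pow_le_pow_left₀ (neg_nonneg.2 h0) h3 _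
    have h6 : (-s) ^ M * (1 + s) ≤ c ^ (M - N ^ 2) * (1 / (N ^ 2 + 1)) := by
      rw [e, mul_assoc]
      have h7 : 0 ≤ (-s) ^ (N ^ 2) := pow_nonneg (neg_nonneg.2 h0) _
      rw [sub_neg_eq_add] at h4
      push_cast at h4
      exact mul_le_mul h5 h4 (by positivity) (by positivity)
    rw [mul_one_div] at h6
    linarith

/-- The two principal terms of the spectral formula give the survival probability, up to an
explicit error. -/
lemma abs_survival_sub_le {N M : ℕ} (hN : 3 ≤ N) (hM : 2 * N ^ 2 ≤ M) :
    |N * survival N M 1 - 2 * Real.cos (Real.pi / N) ^ M * (1 + Real.cos (Real.pi / N))| ≤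
      N * (Real.cos (Real.pi / N) ^ (M - N ^ 2) / (N ^ 2 + 1)) +
        (Real.cos (Real.pi / N) ^ 2) ^ (M - 2 * N ^ 2) := by
  obtain ⟨n, rfl⟩ : ∃ n, N = n + 2 := ⟨N - 2, by omega⟩
  have hc := cos_pi_div_pos hN
  have hsplit : ∀ f : ℕ → ℝ, ∑ l ∈ Finset.range (n + 2), f l =
      ∑ l ∈ Finset.range n, f (l + 1) + (f 0 + f (n + 1)) := by
    intro f
    rw [Finset.sum_range_succ, Finset.sum_range_succ']
    ring
  have hterm : ∀ l, 0 ≤ Real.cos (oddAngle (n + 2) l) ^ (2 * (n + 2) ^ 2) *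
      (1 + Real.cos (oddAngle (n + 2) l)) := by
    intro l
    have h1 : 0 ≤ 1 + Real.cos (oddAngle (n + 2) l) := by
      linarith [Real.neg_one_le_cos (oddAngle (n + 2) l)]
    rw [pow_mul]
    positivity
  have hlast := cos_oddAngle_pred (N := n + 2) (by omega)
  rw [show n + 2 - 1 = n + 1 by omega] at hlast
  -- The spectral formula at time `2 * N ^ 2` and Markov's inequality bound the sum of the terms
  -- that are left after part of each power has been estimated.
  have hs : ∑ l ∈ Finset.range n, Real.cos (oddAngle (n + 2) (l + 1)) ^ (2 * (n + 2) ^ 2) *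
      (1 + Real.cos (oddAngle (n + 2) (l + 1))) ≤ 1 := by
    have h1 := survival_one_eq_sum (N := n + 2) (by omega) (2 * (n + 2) ^ 2)
    rw [hsplit] at h1
    have h2 := survival_mul_le (N := n + 2) (x := 1) (by omega) (2 * (n + 2) ^ 2)
    have h3 := hterm 0
    have h4 := hterm (n + 1)
    push_cast at h1 h2
    have hn : (0 : ℝ) ≤ n := Nat.cast_nonneg n
    have h5 : ((n : ℝ) + 2) * survival (n + 2) (2 * (n + 2) ^ 2) 1 ≤ 1 := by
      by_contra! h
      nlinarith
    linarith
  rw [survival_one_eq_sum (by omega), hsplit, oddAngle_zero, hlast]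
  have e : ∀ a b : ℝ, a + (b * (1 + Real.cos (Real.pi / (n + 2 : ℕ))) +
      b * (1 + Real.cos (Real.pi / (n + 2 : ℕ)))) -
      2 * b * (1 + Real.cos (Real.pi / (n + 2 : ℕ))) = a := fun a b => by ring
  rw [e]
  refine (Finset.abs_sum_le_sum_abs _ _).trans ((Finset.sum_le_sum fun l hl =>
    abs_term_le (Nat.succ_pos l) (by have := Finset.mem_range.1 hl; omega) hM).trans ?_)
  rw [Finset.sum_add_distrib, ← Finset.mul_sum]
  refine add_le_add ?_ ?_
  · rw [Finset.sum_const, Finset.card_range, nsmul_eq_mul]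
    refine mul_le_mul_of_nonneg_right ?_ (by positivity)
    push_cast; linarith
  · exact mul_le_of_le_one_right (by positivity) hs

/-! ### Asymptotics of the probability of surviving an excursion -/

lemma cos_pi_div_pow_le {N : ℕ} (hN : 3 ≤ N) (M : ℕ) :
    Real.cos (Real.pi / N) ^ M ≤ Real.exp (-(M / (N : ℝ) ^ 2)) := by
  have hNR : (3 : ℝ) ≤ N := by exact_mod_cast hN
  have hN0 : (0 : ℝ) < N := by linarith
  have h1 : 1 / (N : ℝ) ≤ Real.sin (Real.pi / N / 2) := by
    have := Real.mul_le_sin (x := Real.pi / N / 2) (by positivity)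
      (by rw [div_div, mul_comm, ← div_div]; exact div_le_self (by positivity) (by linarith))
    refine le_trans (le_of_eq ?_) this
    field_simp
  have h2 : Real.cos (Real.pi / N) = 1 - 2 * Real.sin (Real.pi / N / 2) ^ 2 := by
    have := Real.cos_two_mul (Real.pi / N / 2)
    rw [Real.cos_sq'] at this
    rw [show Real.pi / N = 2 * (Real.pi / N / 2) by ring, this]
    ring_nf
  have h3 : Real.cos (Real.pi / N) ≤ Real.exp (-(1 / (N : ℝ) ^ 2)) := by
    have h4 : (1 / (N : ℝ)) ^ 2 ≤ Real.sin (Real.pi / N / 2) ^ 2 := by gcongr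
    have h5 := Real.add_one_le_exp (-(1 / (N : ℝ) ^ 2))
    rw [one_div_pow] at h4
    have h6 : 0 ≤ 1 / (N : ℝ) ^ 2 := by positivity
    linarith
  refine (pow_le_pow_left₀ (cos_pi_div_pos hN).le h3 M).trans (le_of_eq ?_)
  rw [← Real.exp_nat_mul]
  congr 1
  ring

/-- The power `N ^ 2` of the principal eigenvalue is bounded below uniformly in `N`. -/
lemma exp_neg_le_cos_pi_div_pow {N : ℕ} (hN : 4 ≤ N) :
    Real.exp (-10) ≤ Real.cos (Real.pi / N) ^ (N ^ 2) := by
  have hNR : (4 : ℝ) ≤ N := by exact_mod_cast hN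
  have hN0 : (0 : ℝ) < N := by linarith
  have hpi : Real.pi ^ 2 ≤ 10 := by nlinarith [Real.pi_lt_d2, Real.pi_pos]
  have h1 := Real.one_sub_sq_div_two_le_cos (x := Real.pi / N)
  -- `π ^ 2 / 2 ≤ 5`, so `cos (π / N) ≥ 1 - u`, and `1 - u ≥ exp (-2u)` as `u ≤ 1 / 2`.
  set u : ℝ := 5 / (N : ℝ) ^ 2 with hu
  have hu1 : u ≤ 1 / 2 := by rw [hu, div_le_iff₀ (by positivity)]; nlinarith
  have hu0 : 0 < u := by positivity
  have h2 : 1 - u ≤ Real.cos (Real.pi / N) := by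
    refine le_trans ?_ h1
    have : (Real.pi / N) ^ 2 / 2 ≤ u := by
      rw [div_pow, hu, div_div, div_le_div_iff₀ (by positivity) (by positivity)]
      nlinarith [sq_nonneg (N : ℝ)]
    linarith
  have h3 : Real.exp (-(2 * u)) ≤ 1 - u := by
    rw [Real.exp_neg, inv_le_iff_one_le_mul₀ (Real.exp_pos _)]
    nlinarith [Real.add_one_le_exp (2 * u)]
  calc Real.exp (-10) = Real.exp (-(2 * u)) ^ (N ^ 2) := by
        rw [← Real.exp_nat_mul, hu]; congr 1; push_cast; field_simp; norm_num
    _ ≤ _ := pow_le_pow_left₀ (Real.exp_pos _).le (h3.trans h2) _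

/-- The relative error in the principal term of the spectral formula. The powers of
`cos (π / N)` with exponents of order `N ^ 2` lost in the estimates are bounded below. -/
lemma abs_survival_div_sub_le {N M : ℕ} (hN : 4 ≤ N) (hM : 4 * N ^ 2 ≤ M) :
    |N * survival N M 1 / Real.cos (Real.pi / N) ^ M - 2 * (1 + Real.cos (Real.pi / N))| ≤
      Real.exp 10 * (N / (N ^ 2 + 1)) + Real.exp 40 * Real.cos (Real.pi / N) ^ M := by
  have hc := cos_pi_div_pos (N := N) (by omega)
  have hκ := exp_neg_le_cos_pi_div_pow hN
  have hmain := abs_survival_sub_le (N := N) (M := M) (by omega) (by omega)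
  set c := Real.cos (Real.pi / N)
  have hcM : 0 < c ^ M := by positivity
  have hd : N * survival N M 1 / c ^ M - 2 * (1 + c) =
      (N * survival N M 1 - 2 * c ^ M * (1 + c)) / c ^ M := by
    field_simp
  rw [hd, abs_div, abs_of_pos hcM, div_le_iff₀ hcM]
  refine hmain.trans ?_
  have e1 : c ^ (M - N ^ 2) ≤ Real.exp 10 * c ^ M := by
    have : c ^ M = c ^ (M - N ^ 2) * c ^ (N ^ 2) := by rw [← pow_add]; congr 1; omega
    rw [this]
    have h : 1 ≤ Real.exp 10 * c ^ (N ^ 2) := by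
      rw [Real.exp_neg] at hκ
      exact (inv_le_iff_one_le_mul₀' (Real.exp_pos _)).1 hκ
    nlinarith [pow_pos hc (M - N ^ 2)]
  have e2 : (c ^ 2) ^ (M - 2 * N ^ 2) ≤ Real.exp 40 * c ^ M * c ^ M := by
    have : c ^ M * c ^ M = (c ^ 2) ^ (M - 2 * N ^ 2) * (c ^ N ^ 2) ^ 4 := by
      rw [← pow_add, ← pow_mul, ← pow_mul, ← pow_add]; congr 1; omega
    rw [mul_assoc, this]
    have h : 1 ≤ Real.exp 40 * (c ^ (N ^ 2)) ^ 4 := by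
      have h0 : Real.exp 40 = Real.exp 10 ^ 4 := by rw [← Real.exp_nat_mul]; norm_num
      rw [h0, ← mul_pow]
      apply one_le_pow₀
      rw [Real.exp_neg] at hκ
      exact (inv_le_iff_one_le_mul₀' (Real.exp_pos _)).1 hκ
    nlinarith [pow_pos (pow_pos hc 2) (M - 2 * N ^ 2)]
  calc _ ≤ N * (Real.exp 10 * c ^ M / (N ^ 2 + 1)) + Real.exp 40 * c ^ M * c ^ M := by gcongr
    _ = _ := by ring

variable {N : ℕ → ℕ}

lemma tendsto_cos_pi_div (hN : Tendsto N atTop atTop) :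
    Tendsto (fun M => Real.cos (Real.pi / N M)) atTop (nhds 1) := by
  have h : Tendsto (fun M => Real.pi / (N M : ℝ)) atTop (nhds 0) :=
    (tendsto_natCast_atTop_atTop.comp hN).const_div_atTop _
  simpa [Function.comp_def] using (Real.continuous_cos.tendsto 0).comp h

lemma tendsto_div_sq_mul_cos_pow (hN : Tendsto N atTop atTop)
    (hMN : Tendsto (fun M : ℕ => (M : ℝ) / (N M : ℝ) ^ 2) atTop atTop) :
    Tendsto (fun M : ℕ => (M : ℝ) / (N M : ℝ) ^ 2 * Real.cos (Real.pi / N M) ^ M) atTop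
      (nhds 0) := by
  have h := (Real.tendsto_pow_mul_exp_neg_atTop_nhds_zero 1).comp hMN
  refine squeeze_zero' ?_ ?_ h
  · filter_upwards [hN.eventually_ge_atTop 3] with M hM
    have := cos_pi_div_pos hM
    positivity
  · filter_upwards [hN.eventually_ge_atTop 3] with M hM
    have := cos_pi_div_pow_le hM M
    simp only [Function.comp_apply, pow_one]
    gcongr

lemma tendsto_cos_pow (hN : Tendsto N atTop atTop)
    (hMN : Tendsto (fun M : ℕ => (M : ℝ) / (N M : ℝ) ^ 2) atTop atTop) :
    Tendsto (fun M : ℕ => Real.cos (Real.pi / N M) ^ M) atTop (nhds 0) := by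
  have h := Real.tendsto_exp_neg_atTop_nhds_zero.comp hMN
  refine squeeze_zero' ?_ ?_ h
  · filter_upwards [hN.eventually_ge_atTop 3] with M hM
    have := cos_pi_div_pos hM
    positivity
  · filter_upwards [hN.eventually_ge_atTop 3] with M hM
    exact cos_pi_div_pow_le hM M

/-- The probability that an excursion from the boundary is fatal is equivalent to
`(4 / N) cos (π / N) ^ M`. -/
lemma tendsto_survival_div_cos_pow (hN : Tendsto N atTop atTop)
    (hMN : Tendsto (fun M : ℕ => (M : ℝ) / (N M : ℝ) ^ 2) atTop atTop) :
    Tendsto (fun M : ℕ => N M * survival (N M) M 1 / Real.cos (Real.pi / N M) ^ M) atTop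
      (nhds 4) := by
  have h1 : Tendsto (fun M : ℕ => 2 * (1 + Real.cos (Real.pi / N M))) atTop (nhds 4) := by
    convert ((tendsto_cos_pi_div hN).const_add 1).const_mul 2 using 2
    norm_num
  have h2 : Tendsto (fun M : ℕ => (N M : ℝ) / ((N M : ℝ) ^ 2 + 1)) atTop (nhds 0) := by
    have h : Tendsto (fun M : ℕ => 1 / (N M : ℝ)) atTop (nhds 0) :=
      (tendsto_natCast_atTop_atTop.comp hN).const_div_atTop _
    refine squeeze_zero' (Eventually.of_forall fun M => by positivity) ?_ h
    filter_upwards [hN.eventually_ge_atTop 1] with M hM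
    have : (0 : ℝ) < N M := by exact_mod_cast hM
    rw [div_le_div_iff₀ (by positivity) this]
    nlinarith
  have h3 : Tendsto (fun M : ℕ => Real.exp 10 * ((N M : ℝ) / ((N M : ℝ) ^ 2 + 1)) +
      Real.exp 40 * Real.cos (Real.pi / N M) ^ M) atTop (nhds 0) := by
    simpa using (h2.const_mul (Real.exp 10)).add
      ((tendsto_cos_pow hN hMN).const_mul (Real.exp 40))
  have h4 : Tendsto (fun M : ℕ => N M * survival (N M) M 1 / Real.cos (Real.pi / N M) ^ M -
      2 * (1 + Real.cos (Real.pi / N M))) atTop (nhds 0) := by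
    refine squeeze_zero_norm' ?_ h3
    filter_upwards [hN.eventually_ge_atTop 4, hMN.eventually_ge_atTop 4] with M hM hM'
    refine abs_survival_div_sub_le hM ?_
    have : (0 : ℝ) < N M := by exact_mod_cast (show 0 < N M by omega)
    rw [le_div_iff₀ (by positivity)] at hM'
    exact_mod_cast hM'
  simpa using h4.add h1

/-! ### The extinction martingale -/

/-- The absorbing states: interior location and zero energy. -/
def IsDead (N : ℕ) (s : State) : Prop := IsInterior N s.1 ∧ s.2 = 0

instance (N : ℕ) (s : State) : Decidable (IsDead N s) := inferInstanceAs (Decidable (_ ∧ _))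

lemma integrable_of_bounded {α : Type*} [MeasurableSpace α] [DiscreteMeasurableSpace α]
    [Countable α] {μ : Measure α} [IsFiniteMeasure μ] {f : α → ℂ} {C : ℝ} (hf : ∀ s, ‖f s‖ ≤ C) :
    Integrable f μ :=
  Integrable.of_bound (measurable_of_countable f).aestronglyMeasurable C (Eventually.of_forall hf)

lemma integral_stepKernel_of_isInterior {N M x : ℕ} (i : ℕ) (hx : IsInterior N x) {f : State → ℂ}
    {C : ℝ} (hf : ∀ s, ‖f s‖ ≤ C) :
    ∫ s, f s ∂(stepKernel N M (x, i + 1)) = (f (x - 1, i) + f (x + 1, i)) / 2 := by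
  have hne : ((x - 1, i) : State) ≠ (x + 1, i) := by
    intro h; have := congrArg Prod.fst h; simp at this
  have h0 : stepKernel N M (x, i + 1) = (PMF.uniformOfFinset {(x - 1, i), (x + 1, i)}
      (Finset.insert_nonempty _ _)).toMeasure := by
    change (step N M (x, i + 1)).toMeasure = _
    simp [step, hx]
  rw [h0, PMF.integral_eq_tsum _ _ (integrable_of_bounded hf),
    tsum_eq_sum (s := {(x - 1, i), (x + 1, i)}), Finset.sum_pair hne]
  · have hcard : ({(x - 1, i), (x + 1, i)} : Finset State).card = 2 := Finset.card_pair hne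
    simp only [PMF.uniformOfFinset_apply, hcard, Finset.mem_insert, Finset.mem_singleton, true_or,
      or_true, if_true]
    simp
    ring
  · intro b hb
    simp only [PMF.uniformOfFinset_apply, hb, if_false, ENNReal.toReal_zero, zero_smul]

lemma integral_stepKernel_of_not_isInterior {N M x : ℕ} (i : ℕ) (hx : ¬ IsInterior N x)
    (f : State → ℂ) :
    ∫ s, f s ∂(stepKernel N M (x, i)) = f (if x = 0 then 1 else N - 1, M) := by
  have h0 : stepKernel N M (x, i) = (PMF.pure (if x = 0 then 1 else N - 1, M)).toMeasure := by
    change (step N M (x, i)).toMeasure = _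
    simp [step, hx]
  rw [h0, PMF.toMeasure_pure, integral_dirac]

lemma law_map_history_next (N M : ℕ) (z : State) (n : ℕ) :
    (law N M z).map (fun ζ => (Preorder.frestrictLe n ζ, ζ (n + 1))) =
      (law N M z).map (Preorder.frestrictLe n) ⊗ₘ historyKernel N M n := by
  have h := Kernel.partialTraj_compProd_eq_map_traj (X := fun _ => State)
    (κ := historyKernel N M) (Nat.zero_le n) (x₀ := fun _ => z)
  have h2 := Kernel.traj_map_frestrictLe_apply (X := fun _ => State)
    (κ := historyKernel N M) 0 n (fun _ => z)
  rw [law, h2, ← h]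

/-- Markov property: given the history up to time `n`, the next state has law `stepKernel`. -/
lemma integral_history_next (N M : ℕ) (z : State) (n : ℕ)
    {F : ((i : Finset.Iic n) → (fun _ : ℕ => State) i) × State → ℂ} {C : ℝ}
    (hF : ∀ p, ‖F p‖ ≤ C) :
    ∫ ζ, F (Preorder.frestrictLe n ζ, ζ (n + 1)) ∂(law N M z) =
      ∫ ζ, ∫ s, F (Preorder.frestrictLe n ζ, s) ∂(stepKernel N M (ζ n)) ∂(law N M z) := by
  have : IsProbabilityMeasure ((law N M z).map
      (Preorder.frestrictLe (π := fun _ : ℕ => State) n)) :=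
    Measure.isProbabilityMeasure_map (by fun_prop)
  have h1 : ∫ ζ, F (Preorder.frestrictLe n ζ, ζ (n + 1)) ∂(law N M z) =
      ∫ p, F p ∂((law N M z).map (fun ζ => (Preorder.frestrictLe n ζ, ζ (n + 1)))) := by
    rw [integral_map (by fun_prop) (measurable_of_countable F).aestronglyMeasurable]
  rw [h1, law_map_history_next, Measure.integral_compProd (integrable_of_bounded hF),
    integral_map (by fun_prop) (measurable_of_countable _).aestronglyMeasurable]
  rfl

section Martingale

variable {N M : ℕ} {z : State} {r : ℂ} {f : State → ℂ} {C : ℝ}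

/-- The increment at time `n` of the process `r ^ (n ∧ λ) * f (ζ (n ∧ λ))`. -/
noncomputable def increment (N : ℕ) (r : ℂ) (f : State → ℂ) (n : ℕ) (ζ : ℕ → State) : ℂ :=
  if ∀ j : Finset.Iic n, ¬ IsDead N (ζ j) then r ^ n * (r * f (ζ (n + 1)) - f (ζ n)) else 0

/-- The process `r ^ (n ∧ λ) * f (ζ (n ∧ λ))`, as the sum of its increments. -/
noncomputable def stopped (N : ℕ) (r : ℂ) (f : State → ℂ) (n : ℕ) (ζ : ℕ → State) : ℂ :=
  f (ζ 0) + ∑ k ∈ Finset.range n, increment N r f k ζ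

lemma measurable_increment (N : ℕ) (r : ℂ) (f : State → ℂ) (n : ℕ) :
    Measurable (increment N r f n) := by
  let F : ((i : Finset.Iic n) → (fun _ : ℕ => State) i) × State → ℂ := fun p =>
    if ∀ j : Finset.Iic n, ¬ IsDead N (p.1 j) then
      r ^ n * (r * f p.2 - f (p.1 ⟨n, Finset.mem_Iic.2 le_rfl⟩)) else 0
  exact (measurable_of_countable F).comp
    (g := F) (f := fun ζ : ℕ → State => (Preorder.frestrictLe n ζ, ζ (n + 1))) (by fun_prop)

lemma measurable_stopped (N : ℕ) (r : ℂ) (f : State → ℂ) (n : ℕ) :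
    Measurable (stopped N r f n) := by
  refine Measurable.add ((measurable_of_countable f).comp (measurable_pi_apply 0)) ?_
  exact Finset.measurable_sum _ fun k _ => measurable_increment N r f k

lemma norm_pow_mul_sub_le (hr : ‖r‖ ≤ 1) (hf : ∀ s, ‖f s‖ ≤ C) (n : ℕ) (a b : State) :
    ‖r ^ n * (r * f a - f b)‖ ≤ C + C := by
  have hC : 0 ≤ C := (norm_nonneg _).trans (hf a)
  rw [norm_mul, norm_pow]
  have h1 : ‖r‖ ^ n ≤ 1 := pow_le_one₀ (norm_nonneg _) hr
  have h2 : ‖r * f a - f b‖ ≤ C + C := by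
    refine (norm_sub_le _ _).trans (add_le_add ?_ (hf b))
    rw [norm_mul]
    exact (mul_le_of_le_one_left (norm_nonneg _) hr).trans (hf a)
  calc _ ≤ 1 * (C + C) := by gcongr
    _ = _ := one_mul _

lemma norm_increment_le (hr : ‖r‖ ≤ 1) (hf : ∀ s, ‖f s‖ ≤ C) (n : ℕ) (ζ : ℕ → State) :
    ‖increment N r f n ζ‖ ≤ C + C := by
  have hC : 0 ≤ C := (norm_nonneg _).trans (hf (ζ 0))
  unfold increment
  split_ifs
  · exact norm_pow_mul_sub_le hr hf _ _ _
  · simpa using hC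

lemma integral_increment (hr : ‖r‖ ≤ 1) (hf : ∀ s, ‖f s‖ ≤ C)
    (heq : ∀ s, ¬ IsDead N s → r * ∫ s', f s' ∂(stepKernel N M s) = f s) (n : ℕ) :
    ∫ ζ, increment N r f n ζ ∂(law N M z) = 0 := by
  have hC : 0 ≤ C := (norm_nonneg _).trans (hf z)
  let F : ((i : Finset.Iic n) → (fun _ : ℕ => State) i) × State → ℂ := fun p =>
    if ∀ j : Finset.Iic n, ¬ IsDead N (p.1 j) then
      r ^ n * (r * f p.2 - f (p.1 ⟨n, Finset.mem_Iic.2 le_rfl⟩)) else 0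
  have hF : ∀ p, ‖F p‖ ≤ C + C := by
    intro p
    simp only [F]
    split_ifs
    · exact norm_pow_mul_sub_le hr hf _ _ _
    · simpa using hC
  refine (integral_history_next N M z n hF).trans ?_
  refine integral_eq_zero_of_ae (Eventually.of_forall fun ζ => ?_)
  simp only [F, Pi.zero_apply]
  split_ifs with h
  · have hn := heq (ζ n) (h ⟨n, Finset.mem_Iic.2 le_rfl⟩)
    rw [integral_const_mul, integral_sub ((integrable_of_bounded hf).const_mul r)
      (integrable_const _), integral_const_mul, hn]
    simp
  · simp

lemma law_start (N M : ℕ) (z : State) : ∀ᵐ ζ ∂(law N M z), ζ 0 = z := by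
  have h2 := Kernel.traj_map_frestrictLe_apply (X := fun _ => State)
    (κ := historyKernel N M) 0 0 (fun _ => z)
  rw [Kernel.partialTraj_self, Kernel.id_apply] at h2
  have h3 : ∀ᵐ h ∂((law N M z).map (Preorder.frestrictLe (π := fun _ : ℕ => State) 0)),
      h ⟨0, Finset.mem_Iic.2 le_rfl⟩ = z := by
    rw [law, h2, ae_dirac_eq]
    simp
  exact ae_of_ae_map (by fun_prop) h3

lemma integral_stopped (hr : ‖r‖ ≤ 1) (hf : ∀ s, ‖f s‖ ≤ C)
    (heq : ∀ s, ¬ IsDead N s → r * ∫ s', f s' ∂(stepKernel N M s) = f s) (n : ℕ) :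
    ∫ ζ, stopped N r f n ζ ∂(law N M z) = f z := by
  have hint : ∀ k, Integrable (increment N r f k) (law N M z) := fun k =>
    Integrable.of_bound (measurable_increment N r f k).aestronglyMeasurable (C + C)
      (Eventually.of_forall (norm_increment_le hr hf k))
  have hint0 : Integrable (fun ζ : ℕ → State => f (ζ 0)) (law N M z) :=
    Integrable.of_bound ((measurable_of_countable f).comp
      (measurable_pi_apply 0)).aestronglyMeasurable C (Eventually.of_forall fun ζ => hf _)
  have h0 : ∫ ζ, f (ζ 0) ∂(law N M z) = f z := by
    rw [integral_congr_ae (g := fun _ => f z)]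
    · simp
    · filter_upwards [law_start N M z] with ζ h
      rw [h]
  unfold stopped
  rw [integral_add hint0 (integrable_finsetSum _ fun k _ => hint k), h0,
    integral_finsetSum _ fun k _ => hint k]
  simp [integral_increment hr hf heq]

lemma lifetime_le_iff {ζ : ℕ → State} {n : ℕ} :
    lifetime N ζ ≤ n ↔ ∃ k ≤ n, IsDead N (ζ k) := by
  constructor
  · intro h
    by_contra! hc
    have : ((n + 1 : ℕ) : ℕ∞) ≤ lifetime N ζ := by
      refine le_iInf₂ fun k hk => ?_
      by_contra! hlt
      exact hc k (by have : k < n + 1 := by exact_mod_cast hlt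
                     omega) hk
    have := this.trans h
    have : n + 1 ≤ n := by exact_mod_cast this
    omega
  · rintro ⟨k, hk, hd⟩
    exact (iInf₂_le k hd).trans (by exact_mod_cast hk)

lemma stopped_eq (hdead : ∀ s, IsDead N s → f s = 1) (n : ℕ) (ζ : ℕ → State) :
    stopped N r f n ζ =
      if lifetime N ζ ≤ n then r ^ (lifetime N ζ).toNat else r ^ n * f (ζ n) := by
  induction n with
  | zero =>
    simp only [stopped, Finset.range_zero, Finset.sum_empty, add_zero]
    split_ifs with h
    · obtain ⟨k, hk, hd⟩ := lifetime_le_iff.1 h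
      obtain rfl : k = 0 := by omega
      have : lifetime N ζ = 0 := le_antisymm (by exact_mod_cast h) zero_le
      simp [hdead _ hd, this]
    · simp
  | succ n ih =>
    have hs : stopped N r f (n + 1) ζ = stopped N r f n ζ + increment N r f n ζ := by
      rw [stopped, Finset.sum_range_succ, ← add_assoc, stopped]
    have hall : (∀ j : Finset.Iic n, ¬ IsDead N (ζ j)) ↔ ¬ lifetime N ζ ≤ n := by
      rw [lifetime_le_iff]
      push Not
      simp
    rw [hs, ih, increment]
    simp only [hall]
    by_cases h : lifetime N ζ ≤ n
    · have h' : lifetime N ζ ≤ (n + 1 : ℕ) := h.trans (by exact_mod_cast Nat.le_succ n)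
      simp only [h, h', not_true, if_true, if_false, add_zero]
    · simp only [h, not_false_eq_true, if_true, if_false]
      split_ifs with h'
      · have hd : lifetime N ζ = (n + 1 : ℕ) := by
          refine le_antisymm h' ?_
          have := Order.add_one_le_of_lt (not_le.1 h)
          exact_mod_cast this
        have : IsDead N (ζ (n + 1)) := by
          obtain ⟨k, hk, hkd⟩ := lifetime_le_iff.1 h'
          have : ¬ k ≤ n := fun hkn => h (lifetime_le_iff.2 ⟨k, hkn, hkd⟩)
          obtain rfl : k = n + 1 := by omega
          exact hkd
        rw [hdead _ this, hd, ENat.toNat_natCast]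
        ring
      · ring

lemma norm_stopped_le (hr : ‖r‖ ≤ 1) (hf : ∀ s, ‖f s‖ ≤ C)
    (hdead : ∀ s, IsDead N s → f s = 1) (n : ℕ) (ζ : ℕ → State) :
    ‖stopped N r f n ζ‖ ≤ 1 + C := by
  have hC : 0 ≤ C := (norm_nonneg _).trans (hf (ζ 0))
  rw [stopped_eq hdead]
  split_ifs
  · rw [norm_pow]
    linarith [pow_le_one₀ (n := (lifetime N ζ).toNat) (norm_nonneg _) hr]
  · rw [norm_mul, norm_pow]
    have h1 : ‖r‖ ^ n ≤ 1 := pow_le_one₀ (norm_nonneg _) hr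
    linarith [hf (ζ n), mul_le_of_le_one_left (norm_nonneg (f (ζ n))) h1]

lemma tendsto_stopped_of_ne_top (hdead : ∀ s, IsDead N s → f s = 1) {ζ : ℕ → State}
    (h : lifetime N ζ ≠ ⊤) :
    Tendsto (fun n => stopped N r f n ζ) atTop (nhds (r ^ (lifetime N ζ).toNat)) := by
  refine tendsto_const_nhds.congr' ?_
  filter_upwards [eventually_ge_atTop (lifetime N ζ).toNat] with n hn
  rw [stopped_eq hdead, if_pos]
  rw [← ENat.natCast_toNat h]
  exact_mod_cast hn

lemma tendsto_stopped_of_eq_top (hr : ‖r‖ < 1) (hf : ∀ s, ‖f s‖ ≤ C)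
    (hdead : ∀ s, IsDead N s → f s = 1) {ζ : ℕ → State} (h : lifetime N ζ = ⊤) :
    Tendsto (fun n => stopped N r f n ζ) atTop (nhds 0) := by
  have h1 : Tendsto (fun n => ‖r‖ ^ n * C) atTop (nhds 0) := by
    simpa using (tendsto_pow_atTop_nhds_zero_of_lt_one (norm_nonneg r) hr).mul_const C
  refine squeeze_zero_norm (fun n => ?_) h1
  rw [stopped_eq hdead, if_neg (by simp [h]), norm_mul, norm_pow]
  gcongr
  exact hf _

/-- If the lifetime is almost surely finite, then its generating function at a point `r` of the
closed unit disc is the bounded solution of `f = 1` on absorbing states, `f = r * P f` elsewhere. -/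
lemma integral_pow_lifetime (hr : ‖r‖ ≤ 1) (hf : ∀ s, ‖f s‖ ≤ C)
    (hdead : ∀ s, IsDead N s → f s = 1)
    (heq : ∀ s, ¬ IsDead N s → r * ∫ s', f s' ∂(stepKernel N M s) = f s)
    (hfin : ∀ᵐ ζ ∂(law N M z), lifetime N ζ ≠ ⊤) :
    ∫ ζ, r ^ (lifetime N ζ).toNat ∂(law N M z) = f z := by
  have h := tendsto_integral_of_dominated_convergence (μ := law N M z)
    (F := fun n ζ => stopped N r f n ζ) (fun _ => 1 + C)
    (fun n => (measurable_stopped N r f n).aestronglyMeasurable) (integrable_const _)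
    (fun n => Eventually.of_forall (norm_stopped_le hr hf hdead n))
    (hfin.mono fun ζ hζ => tendsto_stopped_of_ne_top hdead hζ)
  simp only [integral_stopped hr hf heq] at h
  exact (tendsto_nhds_unique tendsto_const_nhds h).symm

lemma measurableSet_lifetime_le (N n : ℕ) : MeasurableSet {ζ | lifetime N ζ ≤ n} := by
  simp only [lifetime_le_iff]
  have : {ζ : ℕ → State | ∃ k ≤ n, IsDead N (ζ k)} =
      ⋃ k ∈ Set.Iic n, (fun ζ : ℕ → State => ζ k) ⁻¹' {s | IsDead N s} := by ext; simp
  rw [this]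
  exact MeasurableSet.biUnion (Set.to_countable _) fun k _ =>
    (measurable_pi_apply k) (Set.to_countable _).measurableSet

lemma measurable_lifetime (N : ℕ) : Measurable (lifetime N) := by
  refine ENat.measurable_iff.2 fun n => ?_
  have : lifetime N ⁻¹' {(n : ℕ∞)} =
      {ζ | lifetime N ζ ≤ n} \ ⋃ k ∈ Set.Iio n, {ζ | lifetime N ζ ≤ k} := by
    ext ζ
    simp only [Set.mem_preimage, Set.mem_singleton_iff, Set.mem_sdiff, Set.mem_ofPred_eq,
      Set.mem_iUnion, Set.mem_Iio, not_exists]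
    constructor
    · intro h
      rw [h]
      exact ⟨le_rfl, fun k hk hle => absurd (by exact_mod_cast hle) (not_le.2 hk)⟩
    · rintro ⟨h1, h2⟩
      obtain ⟨m, hm⟩ := ENat.ne_top_iff_exists.1 (h1.trans_lt (ENat.natCast_lt_top n)).ne
      rw [← hm] at h1 h2 ⊢
      have h3 : m ≤ n := by exact_mod_cast h1
      rcases h3.lt_or_eq with h4 | h4
      · exact absurd le_rfl (h2 m h4)
      · rw [h4]
  rw [this]
  exact (measurableSet_lifetime_le N n).diff (MeasurableSet.biUnion (Set.to_countable _)
    fun k _ => measurableSet_lifetime_le N k)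

/-- For `r` in the open unit disc, the modulus of the generating function is at most the
probability that the lifetime is finite. -/
lemma norm_le_measureReal_lifetime_ne_top (hr : ‖r‖ < 1) (hf : ∀ s, ‖f s‖ ≤ C)
    (hdead : ∀ s, IsDead N s → f s = 1)
    (heq : ∀ s, ¬ IsDead N s → r * ∫ s', f s' ∂(stepKernel N M s) = f s) :
    ‖f z‖ ≤ (law N M z).real {ζ | lifetime N ζ ≠ ⊤} := by
  have hmeas : MeasurableSet {ζ | lifetime N ζ ≠ ⊤} :=
    measurable_lifetime N (MeasurableSet.of_discrete (s := {⊤}ᶜ))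
  have h := tendsto_integral_of_dominated_convergence (μ := law N M z)
    (F := fun n ζ => stopped N r f n ζ)
    (f := {ζ | lifetime N ζ ≠ ⊤}.indicator fun ζ => r ^ (lifetime N ζ).toNat) (fun _ => 1 + C)
    (fun n => (measurable_stopped N r f n).aestronglyMeasurable) (integrable_const _)
    (fun n => Eventually.of_forall (norm_stopped_le hr.le hf hdead n))
    (Eventually.of_forall fun ζ => by
      by_cases hζ : lifetime N ζ = ⊤
      · rw [Set.indicator_of_notMem (by simpa using hζ)]
        exact tendsto_stopped_of_eq_top hr hf hdead hζ
      · rw [Set.indicator_of_mem (by simpa using hζ)]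
        exact tendsto_stopped_of_ne_top hdead hζ)
  simp only [integral_stopped hr.le hf heq] at h
  rw [tendsto_nhds_unique tendsto_const_nhds h, integral_indicator hmeas]
  have := norm_setIntegral_le_of_norm_le_const (μ := law N M z) (C := 1)
    (f := fun ζ => r ^ (lifetime N ζ).toNat) (s := {ζ | lifetime N ζ ≠ ⊤}) (measure_lt_top _ _)
    (fun ζ _ => by rw [norm_pow]; exact pow_le_one₀ (norm_nonneg _) hr.le)
  simpa using this

end Martingale

/-! ### The generating function of the lifetime -/

section GeneratingFunction

variable {N M : ℕ} {r : ℂ}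

/-- The truncated generating function `E_x[r ^ T; T ≤ i]` of the exit time `T` of the simple random
walk from the interior, written in terms of the survival probabilities by Abel summation. -/
noncomputable def exitGen (N : ℕ) (r : ℂ) (i x : ℕ) : ℂ :=
  1 - r ^ i * survival N i x - (1 - r) * ∑ k ∈ Finset.range i, r ^ k * survival N k x

/-- The generating function of the lifetime of the walker started at the boundary: the
solution `B` of the renewal equation `B = r ^ (M + 1) * P(T > M) + r * E[r ^ T; T ≤ M] * B`, which
distinguishes whether the first excursion is fatal. Here `T` is the exit time from location `1`. -/
noncomputable def boundaryGen (N M : ℕ) (r : ℂ) : ℂ :=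
  r ^ (M + 1) * survival N M 1 / (1 - r * exitGen N r M 1)

/-- The generating function of the lifetime as a function of the initial state: the walker either
runs out of energy first, or exits the interior first and restarts from the boundary. -/
noncomputable def lifetimeGen (N M : ℕ) (r : ℂ) (s : State) : ℂ :=
  r ^ s.2 * survival N s.2 s.1 + boundaryGen N M r * exitGen N r s.2 s.1

lemma exitGen_of_not_isInterior {x : ℕ} (hx : ¬ IsInterior N x) (i : ℕ) :
    exitGen N r i x = 1 := by
  simp [exitGen, survival_of_not_isInterior hx]

lemma exitGen_zero {x : ℕ} (hx : IsInterior N x) : exitGen N r 0 x = 0 := by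
  simp [exitGen, survival_zero hx]

lemma exitGen_succ {x : ℕ} (hx : IsInterior N x) (i : ℕ) :
    exitGen N r (i + 1) x = r * (exitGen N r i (x - 1) + exitGen N r i (x + 1)) / 2 := by
  have h : ∑ k ∈ Finset.range (i + 1), r ^ k * (survival N k x : ℂ) =
      1 + r * (∑ k ∈ Finset.range i, r ^ k * (survival N k (x - 1) : ℂ) +
        ∑ k ∈ Finset.range i, r ^ k * (survival N k (x + 1) : ℂ)) / 2 := by
    rw [Finset.sum_range_succ', survival_zero hx, ← Finset.sum_add_distrib, Finset.mul_sum,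
      Finset.sum_div, add_comm]
    congr 1
    · simp
    · refine Finset.sum_congr rfl fun k _ => ?_
      rw [survival_succ hx]
      push_cast
      ring
  rw [exitGen, h, survival_succ hx, exitGen, exitGen]
  push_cast
  ring

lemma norm_exitGen_le (hr : ‖r‖ ≤ 1) (i x : ℕ) : ‖exitGen N r i x‖ ≤ 1 - survival N i x := by
  induction i generalizing x with
  | zero =>
    by_cases hx : IsInterior N x
    · simp [exitGen_zero hx, survival_zero hx]
    · simp [exitGen_of_not_isInterior hx, survival_of_not_isInterior hx]
  | succ i ih =>
    by_cases hx : IsInterior N x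
    · rw [exitGen_succ hx, survival_succ hx, norm_div, norm_mul, Complex.norm_ofNat]
      have h1 := norm_add_le (exitGen N r i (x - 1)) (exitGen N r i (x + 1))
      have h2 := mul_le_of_le_one_left
        (norm_nonneg (exitGen N r i (x - 1) + exitGen N r i (x + 1))) hr
      linarith [ih (x - 1), ih (x + 1)]
    · simp [exitGen_of_not_isInterior hx, survival_of_not_isInterior hx]

lemma survival_le_norm_denom (hr : ‖r‖ ≤ 1) :
    survival N M 1 ≤ ‖1 - r * exitGen N r M 1‖ := by
  have h1 := norm_sub_norm_le (1 : ℂ) (r * exitGen N r M 1)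
  rw [norm_one, norm_mul] at h1
  have h2 := mul_le_of_le_one_left (norm_nonneg (exitGen N r M 1)) hr
  linarith [norm_exitGen_le (N := N) hr M 1]

lemma denom_ne_zero (hr : ‖r‖ ≤ 1) (hp : 0 < survival N M 1) :
    1 - r * exitGen N r M 1 ≠ 0 :=
  norm_pos_iff.1 (hp.trans_le (survival_le_norm_denom hr))

lemma norm_pow_mul_survival_le (hr : ‖r‖ ≤ 1) (k i x : ℕ) :
    ‖r ^ k * (survival N i x : ℂ)‖ ≤ survival N i x := by
  rw [norm_mul, norm_pow, Complex.norm_real, Real.norm_of_nonneg (survival_nonneg _ _ _)]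
  exact mul_le_of_le_one_left (survival_nonneg _ _ _) (pow_le_one₀ (norm_nonneg _) hr)

lemma norm_boundaryGen_le (hr : ‖r‖ ≤ 1) (hp : 0 < survival N M 1) :
    ‖boundaryGen N M r‖ ≤ 1 := by
  rw [boundaryGen, norm_div, div_le_one (norm_pos_iff.2 (denom_ne_zero hr hp))]
  exact (norm_pow_mul_survival_le hr _ _ _).trans (survival_le_norm_denom hr)

lemma norm_lifetimeGen_le (hr : ‖r‖ ≤ 1) (hp : 0 < survival N M 1) (s : State) :
    ‖lifetimeGen N M r s‖ ≤ 1 := by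
  have h1 := norm_add_le (r ^ s.2 * (survival N s.2 s.1 : ℂ))
    (boundaryGen N M r * exitGen N r s.2 s.1)
  rw [norm_mul (boundaryGen N M r)] at h1
  have h2 := mul_le_of_le_one_left (norm_nonneg (exitGen N r s.2 s.1)) (norm_boundaryGen_le hr hp)
  have h3 := norm_exitGen_le (N := N) hr s.2 s.1
  have h4 := norm_pow_mul_survival_le (N := N) hr s.2 s.2 s.1
  rw [lifetimeGen]
  linarith

lemma lifetimeGen_of_isDead {s : State} (hs : IsDead N s) : lifetimeGen N M r s = 1 := by
  rw [lifetimeGen, hs.2, exitGen_zero hs.1, survival_zero hs.1]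
  simp

lemma mul_lifetimeGen_one (hr : ‖r‖ ≤ 1) (hp : 0 < survival N M 1) :
    r * lifetimeGen N M r (1, M) = boundaryGen N M r := by
  have h := denom_ne_zero hr hp
  have h1 : boundaryGen N M r * (1 - r * exitGen N r M 1) = r ^ (M + 1) * survival N M 1 :=
    div_mul_cancel₀ _ h
  rw [lifetimeGen]
  linear_combination -h1

lemma lifetimeGen_reflect {x : ℕ} (hx : x ≤ N) (i : ℕ) :
    lifetimeGen N M r (N - x, i) = lifetimeGen N M r (x, i) := by
  simp only [lifetimeGen, exitGen, survival_reflect N _ x hx]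

lemma mul_integral_lifetimeGen (hN : 2 ≤ N) (hr : ‖r‖ ≤ 1) (hp : 0 < survival N M 1) (s : State)
    (hs : ¬ IsDead N s) :
    r * ∫ s', lifetimeGen N M r s' ∂(stepKernel N M s) = lifetimeGen N M r s := by
  obtain ⟨x, i⟩ := s
  by_cases hx : IsInterior N x
  · obtain ⟨j, rfl⟩ : ∃ j, i = j + 1 := ⟨i - 1, by
      have : i ≠ 0 := fun h => hs ⟨hx, h⟩
      omega⟩
    rw [integral_stepKernel_of_isInterior j hx (norm_lifetimeGen_le hr hp)]
    simp only [lifetimeGen, exitGen_succ hx, survival_succ hx]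
    push_cast
    ring
  · have h1 : lifetimeGen N M r (if x = 0 then 1 else N - 1, M) = lifetimeGen N M r (1, M) := by
      split_ifs
      · rfl
      · exact lifetimeGen_reflect (by omega) M
    rw [integral_stepKernel_of_not_isInterior i hx, h1, mul_lifetimeGen_one hr hp, lifetimeGen,
      exitGen_of_not_isInterior hx, survival_of_not_isInterior hx]
    simp

/-- The lifetime is almost surely finite, because its generating function is continuous at `1`. -/
lemma lifetime_ne_top (hN : 2 ≤ N) (hp : 0 < survival N M 1) (z : State) :
    ∀ᵐ ζ ∂(law N M z), lifetime N ζ ≠ ⊤ := by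
  have hmeas : MeasurableSet {ζ | lifetime N ζ ≠ ⊤} :=
    measurable_lifetime N (MeasurableSet.of_discrete (s := {⊤}ᶜ))
  -- A sequence in `[0, 1)` increasing to `1`.
  let ρ : ℕ → ℝ := fun n => 1 - 1 / ((n : ℝ) + 1)
  have hρ : Tendsto (fun n => (ρ n : ℂ)) atTop (nhds 1) := by
    have : Tendsto ρ atTop (nhds 1) := by
      simpa [ρ] using (tendsto_one_div_add_atTop_nhds_zero_nat (𝕜 := ℝ)).const_sub 1
    simpa [Function.comp_def] using (Complex.continuous_ofReal.tendsto 1).comp this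
  have hρ1 : ∀ n, ‖(ρ n : ℂ)‖ < 1 := by
    intro n
    have h1 : 0 < 1 / ((n : ℝ) + 1) := by positivity
    have h2 : 1 / ((n : ℝ) + 1) ≤ 1 := by
      rw [div_le_one (by positivity)]; linarith [Nat.cast_nonneg (α := ℝ) n]
    rw [Complex.norm_real, Real.norm_of_nonneg (by simp only [ρ]; linarith)]
    simp only [ρ]; linarith
  have hcont : ContinuousAt (fun r => lifetimeGen N M r z) 1 := by
    have h1 : ∀ i x, Continuous fun r => exitGen N r i x := by
      intro i x; unfold exitGen; fun_prop
    have h2 : ContinuousAt (fun r => boundaryGen N M r) 1 := by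
      refine ContinuousAt.div (by fun_prop) ?_ (denom_ne_zero (by simp) hp)
      exact (continuous_const.sub (continuous_id.mul (h1 M 1))).continuousAt
    exact (by fun_prop : Continuous fun r : ℂ =>
      r ^ z.2 * (survival N z.2 z.1 : ℂ)).continuousAt.add (h2.mul (h1 _ _).continuousAt)
  have hone : lifetimeGen N M 1 z = 1 := by
    have : (survival N M 1 : ℂ) ≠ 0 := by exact_mod_cast hp.ne'
    simp [lifetimeGen, boundaryGen, exitGen, this]
  have hlim : Tendsto (fun n => ‖lifetimeGen N M (ρ n) z‖) atTop (nhds 1) := by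
    have := (hcont.tendsto.comp hρ).norm
    rw [hone, norm_one] at this
    exact this
  have hge : 1 ≤ (law N M z).real {ζ | lifetime N ζ ≠ ⊤} :=
    le_of_tendsto' hlim fun n => norm_le_measureReal_lifetime_ne_top (hρ1 n)
      (norm_lifetimeGen_le (hρ1 n).le hp) (fun _ => lifetimeGen_of_isDead)
      (mul_integral_lifetimeGen hN (hρ1 n).le hp)
  have heq : (law N M z).real {ζ | lifetime N ζ ≠ ⊤} = 1 := le_antisymm measureReal_le_one hge
  rw [Measure.real, ENNReal.toReal_eq_one_iff] at heq
  exact (mem_ae_iff_prob_eq_one hmeas).2 heq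

lemma integral_pow_lifetime_eq (hN : 2 ≤ N) (hr : ‖r‖ ≤ 1) (hp : 0 < survival N M 1) (z : State) :
    ∫ ζ, r ^ (lifetime N ζ).toNat ∂(law N M z) = lifetimeGen N M r z :=
  integral_pow_lifetime hr (norm_lifetimeGen_le hr hp) (fun _ => lifetimeGen_of_isDead)
    (mul_integral_lifetimeGen hN hr hp) (lifetime_ne_top hN hp z)

end GeneratingFunction

/-! ### Convergence of the characteristic functions -/

lemma norm_pow_sub_one_le {r : ℂ} (hr : ‖r‖ ≤ 1) (k : ℕ) : ‖r ^ k - 1‖ ≤ k * ‖1 - r‖ := by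
  induction k with
  | zero => simp
  | succ k ih =>
    have e : r ^ (k + 1) - 1 = r ^ k * (r - 1) + (r ^ k - 1) := by ring
    rw [e]
    refine (norm_add_le _ _).trans ?_
    rw [norm_mul, norm_pow, norm_sub_rev r 1]
    have := mul_le_of_le_one_left (norm_nonneg (1 - r)) (pow_le_one₀ (n := k) (norm_nonneg r) hr)
    push_cast
    linarith

/-- The mean-duration factor `1 + ∑ k < M, r ^ (k + 1) q_k` of the renewal equation, which is close
to the mean duration `N` of an excursion from the boundary when `r` is close to `1`. -/
noncomputable def excursionSum (N M : ℕ) (r : ℂ) : ℂ :=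
  1 + ∑ k ∈ Finset.range M, r ^ (k + 1) * survival N k 1

lemma denom_eq (N M : ℕ) (r : ℂ) :
    1 - r * exitGen N r M 1 = r ^ (M + 1) * survival N M 1 + (1 - r) * excursionSum N M r := by
  have h : ∑ k ∈ Finset.range M, r ^ (k + 1) * (survival N k 1 : ℂ) =
      r * ∑ k ∈ Finset.range M, r ^ k * (survival N k 1 : ℂ) := by
    rw [Finset.mul_sum]
    exact Finset.sum_congr rfl fun k _ => by ring
  rw [exitGen, excursionSum, h]
  ring

lemma norm_excursionSum_sub_le {N M : ℕ} {r : ℂ} (hN : 1 ≤ N) (hr : ‖r‖ ≤ 1) :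
    ‖excursionSum N M r - N‖ ≤ M * ‖1 - r‖ * N + N ^ 2 / 4 * survival N M 1 := by
  have h1 := sum_survival_le hN M
  have h2 := le_sum_survival hN M
  rw [Nat.cast_one, one_mul] at h1 h2
  have e : excursionSum N M r - N =
      ∑ k ∈ Finset.range M, (r ^ (k + 1) - 1) * (survival N k 1 : ℂ) +
        ((1 + ∑ k ∈ Finset.range M, survival N k 1 - N : ℝ) : ℂ) := by
    rw [excursionSum]
    push_cast
    simp only [sub_mul, one_mul, Finset.sum_sub_distrib]
    ring
  rw [e]
  refine (norm_add_le _ _).trans (add_le_add ?_ ?_)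
  · refine (norm_sum_le _ _).trans ?_
    calc ∑ k ∈ Finset.range M, ‖(r ^ (k + 1) - 1) * (survival N k 1 : ℂ)‖
        ≤ ∑ k ∈ Finset.range M, M * ‖1 - r‖ * survival N k 1 := by
          refine Finset.sum_le_sum fun k hk => ?_
          rw [norm_mul, Complex.norm_real, Real.norm_of_nonneg (survival_nonneg _ _ _)]
          refine mul_le_mul_of_nonneg_right ?_ (survival_nonneg _ _ _)
          refine (norm_pow_sub_one_le hr _).trans ?_
          have : k + 1 ≤ M := Finset.mem_range.1 hk
          gcongr
      _ = M * ‖1 - r‖ * ∑ k ∈ Finset.range M, survival N k 1 := by rw [Finset.mul_sum]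
      _ ≤ M * ‖1 - r‖ * N := by gcongr; linarith
  · rw [Complex.norm_real, Real.norm_eq_abs, abs_le]
    constructor
    · linarith
    · have := survival_nonneg N M 1
      have : 0 ≤ (N : ℝ) ^ 2 / 4 * survival N M 1 := by positivity
      linarith

/-- Replacing the initial state by a boundary state costs little if the walker is likely to exit
the interior before using up its initial energy. -/
lemma norm_lifetimeGen_sub_boundaryGen_le {N M : ℕ} {r : ℂ} (hr : ‖r‖ ≤ 1)
    (hp : 0 < survival N M 1) (x i : ℕ) :
    ‖lifetimeGen N M r (x, i) - boundaryGen N M r‖ ≤ 2 * survival N i x + i * ‖1 - r‖ := by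
  have hB := norm_boundaryGen_le hr hp
  set B := boundaryGen N M r
  have e : lifetimeGen N M r (x, i) - B = (1 - B) * (r ^ i * survival N i x) -
      B * ((1 - r) * ∑ k ∈ Finset.range i, r ^ k * (survival N k x : ℂ)) := by
    simp only [lifetimeGen, exitGen, B]
    ring
  have hS : ‖∑ k ∈ Finset.range i, r ^ k * (survival N k x : ℂ)‖ ≤ i := by
    refine (norm_sum_le_of_le _ fun k _ => (norm_pow_mul_survival_le hr k k x).trans
      (survival_le_one N k x)).trans ?_
    simp
  have h1 : ‖1 - B‖ ≤ 2 := (norm_sub_le _ _).trans (by rw [norm_one]; linarith)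
  rw [e]
  refine (norm_sub_le _ _).trans (add_le_add ?_ ?_)
  · rw [norm_mul]
    exact mul_le_mul h1 (norm_pow_mul_survival_le hr i i x) (norm_nonneg _) (by norm_num)
  · rw [norm_mul, norm_mul]
    refine (mul_le_of_le_one_left (by positivity) hB).trans ?_
    rw [mul_comm]
    gcongr

/-- The scaling factor of the lifetime. -/
noncomputable def scale (N M : ℕ) : ℝ := 4 * Real.cos (Real.pi / N) ^ M / N ^ 2

lemma scale_pos {N : ℕ} (hN : 3 ≤ N) (M : ℕ) : 0 < scale N M := by
  have := cos_pi_div_pos hN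
  have : 0 < N := by omega
  unfold scale
  positivity

/-- The point of the unit circle at which the generating function of the lifetime is the
characteristic function of the scaled lifetime at `t`. -/
noncomputable def circlePoint (N M : ℕ) (t : ℝ) : ℂ := Complex.exp (Complex.I * (t * scale N M : ℝ))

lemma norm_circlePoint (N M : ℕ) (t : ℝ) : ‖circlePoint N M t‖ = 1 := by
  rw [circlePoint, mul_comm, Complex.norm_exp_ofReal_mul_I]

lemma norm_one_sub_circlePoint_le {N : ℕ} (hN : 3 ≤ N) (M : ℕ) (t : ℝ) :
    ‖1 - circlePoint N M t‖ ≤ |t| * scale N M := by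
  rw [norm_sub_rev, circlePoint]
  refine (Real.norm_exp_I_mul_ofReal_sub_one_le).trans ?_
  rw [Real.norm_eq_abs, abs_mul, abs_of_pos (scale_pos hN M)]

section Limits

variable {N : ℕ → ℕ}

lemma tendsto_mul_scale (hN : Tendsto N atTop atTop)
    (hMN : Tendsto (fun M : ℕ => (M : ℝ) / (N M : ℝ) ^ 2) atTop atTop) :
    Tendsto (fun M : ℕ => (M : ℝ) * scale (N M) M) atTop (nhds 0) := by
  have := (tendsto_div_sq_mul_cos_pow hN hMN).const_mul 4
  rw [mul_zero] at this
  refine this.congr fun M => ?_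
  rw [scale]
  ring

lemma tendsto_scale (hN : Tendsto N atTop atTop)
    (hMN : Tendsto (fun M : ℕ => (M : ℝ) / (N M : ℝ) ^ 2) atTop atTop) :
    Tendsto (fun M : ℕ => scale (N M) M) atTop (nhds 0) := by
  refine squeeze_zero' ?_ ?_ (tendsto_mul_scale hN hMN)
  · filter_upwards [hN.eventually_ge_atTop 3] with M hM using (scale_pos hM M).le
  · filter_upwards [hN.eventually_ge_atTop 3, eventually_ge_atTop 1] with M hM h1
    have : (1 : ℝ) ≤ M := by exact_mod_cast h1
    nlinarith [scale_pos hM M]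

lemma tendsto_mul_norm_one_sub_circlePoint (hN : Tendsto N atTop atTop)
    (hMN : Tendsto (fun M : ℕ => (M : ℝ) / (N M : ℝ) ^ 2) atTop atTop) (t : ℝ) :
    Tendsto (fun M : ℕ => (M : ℝ) * ‖1 - circlePoint (N M) M t‖) atTop (nhds 0) := by
  have h := (tendsto_mul_scale hN hMN).const_mul |t|
  rw [mul_zero] at h
  refine squeeze_zero' (Eventually.of_forall fun M => by positivity) ?_ h
  filter_upwards [hN.eventually_ge_atTop 3] with M hM
  calc (M : ℝ) * ‖1 - circlePoint (N M) M t‖ ≤ M * (|t| * scale (N M) M) := by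
        gcongr; exact norm_one_sub_circlePoint_le hM M t
    _ = _ := by ring

lemma tendsto_circlePoint_pow (hN : Tendsto N atTop atTop)
    (hMN : Tendsto (fun M : ℕ => (M : ℝ) / (N M : ℝ) ^ 2) atTop atTop) (t : ℝ) :
    Tendsto (fun M : ℕ => circlePoint (N M) M t ^ (M + 1)) atTop (nhds 1) := by
  rw [tendsto_iff_norm_sub_tendsto_zero]
  have h := (tendsto_mul_norm_one_sub_circlePoint hN hMN t).const_mul 2
  rw [mul_zero] at h
  refine squeeze_zero' (Eventually.of_forall fun M => norm_nonneg _) ?_ h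
  filter_upwards [eventually_ge_atTop 1] with M hM
  refine (norm_pow_sub_one_le (norm_circlePoint _ _ _).le _).trans ?_
  have : (1 : ℝ) ≤ M := by exact_mod_cast hM
  push_cast
  nlinarith [norm_nonneg (1 - circlePoint (N M) M t)]

lemma eventually_survival_pos (hN : Tendsto N atTop atTop)
    (hMN : Tendsto (fun M : ℕ => (M : ℝ) / (N M : ℝ) ^ 2) atTop atTop) :
    ∀ᶠ M in atTop, 0 < survival (N M) M 1 := by
  have h := (tendsto_survival_div_cos_pow hN hMN).eventually (lt_mem_nhds (by norm_num : (0:ℝ) < 4))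
  filter_upwards [h] with M hM
  refine (survival_nonneg _ _ _).lt_of_ne' fun h0 => ?_
  simp [h0] at hM

lemma tendsto_mul_survival (hN : Tendsto N atTop atTop)
    (hMN : Tendsto (fun M : ℕ => (M : ℝ) / (N M : ℝ) ^ 2) atTop atTop) :
    Tendsto (fun M => (N M : ℝ) * survival (N M) M 1) atTop (nhds 0) := by
  have h := (tendsto_survival_div_cos_pow hN hMN).mul (tendsto_cos_pow hN hMN)
  rw [mul_zero] at h
  refine h.congr' ?_
  filter_upwards [hN.eventually_ge_atTop 3] with M hM
  exact div_mul_cancel₀ _ (pow_pos (cos_pi_div_pos hM) M).ne'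

lemma tendsto_scale_mul_div_survival (hN : Tendsto N atTop atTop)
    (hMN : Tendsto (fun M : ℕ => (M : ℝ) / (N M : ℝ) ^ 2) atTop atTop) :
    Tendsto (fun M => scale (N M) M * N M / survival (N M) M 1) atTop (nhds 1) := by
  have h := (tendsto_const_nhds (x := (4 : ℝ))).div (tendsto_survival_div_cos_pow hN hMN)
    four_ne_zero
  rw [div_self four_ne_zero] at h
  refine h.congr' ?_
  filter_upwards [hN.eventually_ge_atTop 3, eventually_survival_pos hN hMN] with M hM hp
  have h1 := cos_pi_div_pos hM
  have h2 : (0 : ℝ) < N M := by exact_mod_cast (by omega : 0 < N M)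
  simp only [Pi.div_apply, scale]
  field_simp

lemma tendsto_excursionSum_div (hN : Tendsto N atTop atTop)
    (hMN : Tendsto (fun M : ℕ => (M : ℝ) / (N M : ℝ) ^ 2) atTop atTop) (t : ℝ) :
    Tendsto (fun M => excursionSum (N M) M (circlePoint (N M) M t) / (N M : ℂ)) atTop (nhds 1) := by
  rw [tendsto_iff_norm_sub_tendsto_zero]
  have h := (tendsto_mul_norm_one_sub_circlePoint hN hMN t).add
    ((tendsto_mul_survival hN hMN).div_const 4)
  rw [zero_div, add_zero] at h
  refine squeeze_zero' (Eventually.of_forall fun M => norm_nonneg _) ?_ h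
  filter_upwards [hN.eventually_ge_atTop 1] with M hM
  have h2 : (0 : ℝ) < N M := by exact_mod_cast hM
  have h3 : (N M : ℂ) ≠ 0 := by exact_mod_cast h2.ne'
  rw [div_sub_one h3, norm_div, Complex.norm_natCast, div_le_iff₀ h2]
  refine (norm_excursionSum_sub_le hM (norm_circlePoint _ _ _).le).trans (le_of_eq ?_)
  ring

lemma tendsto_one_sub_circlePoint_div_scale (hN : Tendsto N atTop atTop)
    (hMN : Tendsto (fun M : ℕ => (M : ℝ) / (N M : ℝ) ^ 2) atTop atTop) (t : ℝ) :
    Tendsto (fun M => (1 - circlePoint (N M) M t) / (scale (N M) M : ℂ)) atTop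
      (nhds (-(t * Complex.I))) := by
  have hd : HasDerivAt (fun s : ℝ => Complex.exp (Complex.I * (t * s : ℝ))) (t * Complex.I) 0 := by
    have h1 : HasDerivAt (fun s : ℝ => ((t * s : ℝ) : ℂ)) (t : ℂ) 0 := by
      simpa using ((hasDerivAt_id (0 : ℝ)).const_mul t).ofReal_comp
    have h2 := (h1.const_mul Complex.I).cexp
    simpa [mul_comm] using h2
  have h := hd.tendsto_slope_zero
  have hs : Tendsto (fun M => scale (N M) M) atTop (nhdsWithin 0 {0}ᶜ) := by
    refine tendsto_nhdsWithin_iff.2 ⟨tendsto_scale hN hMN, ?_⟩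
    filter_upwards [hN.eventually_ge_atTop 3] with M hM using (scale_pos hM M).ne'
  refine ((h.comp hs).neg).congr fun M => ?_
  simp only [Function.comp_apply, zero_add, mul_zero, Complex.ofReal_zero, Complex.exp_zero,
    circlePoint, Complex.real_smul, Complex.ofReal_inv]
  ring

/-- In the renewal equation for the walker started at the boundary, dividing numerator and
denominator by the probability of a fatal excursion leaves `1` over `1 - i t` in the limit. -/
lemma tendsto_boundaryGen (hN : Tendsto N atTop atTop)
    (hMN : Tendsto (fun M : ℕ => (M : ℝ) / (N M : ℝ) ^ 2) atTop atTop) (t : ℝ) :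
    Tendsto (fun M => boundaryGen (N M) M (circlePoint (N M) M t)) atTop
      (nhds (1 / (1 - t * Complex.I))) := by
  have h1 := tendsto_circlePoint_pow hN hMN t
  have h2 := (tendsto_one_sub_circlePoint_div_scale hN hMN t).mul
    (((Complex.continuous_ofReal.tendsto 1).comp (tendsto_scale_mul_div_survival hN hMN)).mul
      (tendsto_excursionSum_div hN hMN t))
  have h3 := h1.div (h1.add h2) (by
    intro h
    have := congrArg Complex.re h
    simp at this)
  have e : (1 : ℂ) / (1 + -(t * Complex.I) * (((1 : ℝ) : ℂ) * 1)) = 1 / (1 - t * Complex.I) := by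
    simp [sub_eq_add_neg]
  rw [e] at h3
  refine h3.congr' ?_
  filter_upwards [hN.eventually_ge_atTop 3, eventually_survival_pos hN hMN] with M hM hp
  have hs : (scale (N M) M : ℂ) ≠ 0 := by exact_mod_cast (scale_pos hM M).ne'
  have hNM : (N M : ℂ) ≠ 0 := by exact_mod_cast (by omega : N M ≠ 0)
  have hp' : (survival (N M) M 1 : ℂ) ≠ 0 := by exact_mod_cast hp.ne'
  simp only [Pi.div_apply, Function.comp_apply]
  rw [boundaryGen, denom_eq]
  push_cast
  set r := circlePoint (N M) M t
  have e2 : r ^ (M + 1) * (survival (N M) M 1 : ℂ) + (1 - r) * excursionSum (N M) M r =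
      (r ^ (M + 1) + (1 - r) / (scale (N M) M : ℂ) * ((scale (N M) M : ℂ) * (N M : ℂ) /
        (survival (N M) M 1 : ℂ) * (excursionSum (N M) M r / (N M : ℂ)))) *
          (survival (N M) M 1 : ℂ) := by
    field_simp
  rw [e2, mul_div_mul_right _ _ hp']

/-- The initial energy suffices to reach the boundary with high probability. -/
lemma tendsto_survival_start {x y : ℕ → ℕ} (hN : Tendsto N atTop atTop)
    (hMN : Tendsto (fun M : ℕ => (M : ℝ) / (N M : ℝ) ^ 2) atTop atTop)
    (hx : ∀ M, 1 ≤ M → x M ≤ N M)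
    (hy_lim : 0 < liminf (fun M : ℕ => (y M : ℝ) / (M : ℝ)) atTop) :
    Tendsto (fun M => survival (N M) (y M) (x M)) atTop (nhds 0) := by
  obtain ⟨a, ha0, ha⟩ := exists_between hy_lim
  have hev : ∀ᶠ M in atTop, a < (y M : ℝ) / (M : ℝ) :=
    eventually_lt_of_lt_liminf ha
      ⟨0, Filter.eventually_map.2 (Eventually.of_forall fun M => by positivity)⟩
  have h := hMN.const_div_atTop (1 / (4 * a))
  refine squeeze_zero' (Eventually.of_forall fun M => survival_nonneg _ _ _) ?_ h
  filter_upwards [hev, eventually_ge_atTop 1, hN.eventually_ge_atTop 1] with M hM h1 hNM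
  have hM0 : (0 : ℝ) < M := by exact_mod_cast h1
  have hN0 : (0 : ℝ) < N M := by exact_mod_cast hNM
  have h2 := survival_mul_le (hx M h1) (y M)
  have h3 : survival (N M) (y M) (x M) * (a * M) ≤ (N M : ℝ) ^ 2 / 4 := by
    rw [lt_div_iff₀ hM0] at hM
    nlinarith [survival_nonneg (N M) (y M) (x M), sq_nonneg ((x M : ℝ) - N M / 2)]
  rw [← le_div_iff₀ (by positivity)] at h3
  refine h3.trans (le_of_eq ?_)
  field_simp

lemma tendsto_lifetimeGen {x y : ℕ → ℕ} (hN : Tendsto N atTop atTop)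
    (hMN : Tendsto (fun M : ℕ => (M : ℝ) / (N M : ℝ) ^ 2) atTop atTop)
    (hx : ∀ M, 1 ≤ M → x M ≤ N M) (hy : ∀ M, 1 ≤ M → y M ≤ M)
    (hy_lim : 0 < liminf (fun M : ℕ => (y M : ℝ) / (M : ℝ)) atTop) (t : ℝ) :
    Tendsto (fun M => lifetimeGen (N M) M (circlePoint (N M) M t) (x M, y M)) atTop
      (nhds (1 / (1 - t * Complex.I))) := by
  have h1 := ((tendsto_survival_start hN hMN hx hy_lim).const_mul 2).add
    (tendsto_mul_norm_one_sub_circlePoint hN hMN t)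
  rw [mul_zero, add_zero] at h1
  have h2 : Tendsto (fun M => lifetimeGen (N M) M (circlePoint (N M) M t) (x M, y M) -
      boundaryGen (N M) M (circlePoint (N M) M t)) atTop (nhds 0) := by
    refine squeeze_zero_norm' ?_ h1
    filter_upwards [eventually_survival_pos hN hMN, eventually_ge_atTop 1] with M hp hM
    refine (norm_lifetimeGen_sub_boundaryGen_le (norm_circlePoint _ _ _).le hp _ _).trans ?_
    have := hy M hM
    gcongr
  simpa using h2.add (tendsto_boundaryGen hN hMN t)

end Limits

/-! ### The exponential limit -/

lemma charFun_expMeasure_one (t : ℝ) : charFun (expMeasure 1) t = 1 / (1 - t * Complex.I) := by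
  have hden : ∀ x : ℝ, (exponentialPDF 1 x).toReal • Complex.exp (t * x * Complex.I) =
      (Set.Ici (0 : ℝ)).indicator (fun x : ℝ => Complex.exp ((t * Complex.I - 1) * x)) x := by
    intro x
    rw [exponentialPDF_eq]
    by_cases hx : 0 ≤ x
    · rw [if_pos hx, Set.indicator_of_mem (by exact hx), ENNReal.toReal_ofReal (by positivity),
        Complex.real_smul]
      push_cast
      rw [one_mul, ← Complex.exp_add]
      congr 1
      ring
    · rw [if_neg hx, Set.indicator_of_notMem (by exact hx)]
      simp
  have hmeas : expMeasure 1 = volume.withDensity (exponentialPDF 1) := rfl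
  have hm : Measurable (exponentialPDF 1) := by
    unfold exponentialPDF
    exact (measurable_exponentialPDFReal 1).ennreal_ofReal
  rw [charFun_apply_real, hmeas, integral_withDensity_eq_integral_toReal_smul hm
    (Eventually.of_forall fun x => by rw [exponentialPDF]; exact ENNReal.ofReal_lt_top)]
  simp only [hden]
  rw [integral_indicator measurableSet_Ici, integral_Ici_eq_integral_Ioi,
    integral_exp_mul_complex_Ioi (by simp)]
  have h : (t * Complex.I - 1 : ℂ) = -(1 - t * Complex.I) := by ring
  rw [h, div_neg, Complex.ofReal_zero, mul_zero, Complex.exp_zero, neg_div, neg_neg]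

/-- The lifetime, scaled as in the limit theorem. -/
noncomputable def scaledLifetime (N M : ℕ) (ζ : ℕ → State) : ℝ :=
  4 * ((lifetime N ζ).toNat : ℝ) / (N : ℝ) ^ 2 * Real.cos (Real.pi / (N : ℝ)) ^ M

lemma measurable_scaledLifetime (N M : ℕ) : Measurable (scaledLifetime N M) :=
  (measurable_of_countable (fun k : ℕ∞ =>
    4 * ((k.toNat : ℕ) : ℝ) / (N : ℝ) ^ 2 * Real.cos (Real.pi / (N : ℝ)) ^ M)).comp
      (measurable_lifetime N)

lemma charFun_map_scaledLifetime {N M : ℕ} (hN : 2 ≤ N) (hp : 0 < survival N M 1) (z : State)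
    (t : ℝ) :
    charFun ((law N M z).map (scaledLifetime N M)) t = lifetimeGen N M (circlePoint N M t) z := by
  rw [charFun_apply_real, integral_map (measurable_scaledLifetime N M).aemeasurable
    (by fun_prop), ← integral_pow_lifetime_eq hN (norm_circlePoint N M t).le hp z]
  refine integral_congr_ae (Eventually.of_forall fun ζ => ?_)
  simp only [circlePoint, ← Complex.exp_nat_mul]
  congr 1
  simp only [scaledLifetime, scale]
  push_cast
  ring


end EnergyWalk

theorem mainTheorem2 (N x y : ℕ → ℕ)
    (hN : ∀ M, 1 ≤ M → 2 ≤ N M)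
    (hx : ∀ M, 1 ≤ M → x M ≤ N M)
    (hy : ∀ M, 1 ≤ M → y M ≤ M)
    (hN_lim : Tendsto N atTop atTop)
    (hMN_lim : Tendsto (fun M : ℕ => (M : ℝ) / (N M : ℝ) ^ 2) atTop atTop)
    (hy_lim : 0 < liminf (fun M : ℕ => (y M : ℝ) / (M : ℝ)) atTop) :
    (∀ᶠ M in atTop,
      ∀ᵐ ζ ∂(EnergyWalk.law (N M) M (x M, y M)), EnergyWalk.lifetime (N M) ζ ≠ ⊤) ∧
    TendstoInDistribution
      (fun (M : ℕ) (ζ : ℕ → EnergyWalk.State) =>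
        4 * ((EnergyWalk.lifetime (N M) ζ).toNat : ℝ) / (N M : ℝ) ^ 2
          * Real.cos (Real.pi / (N M : ℝ)) ^ M)
      atTop
      (fun t : ℝ => t)
      (fun M => EnergyWalk.law (N M) M (x M, y M))
      (expMeasure 1) := by
  have hN' : ∀ᶠ M in atTop, 2 ≤ N M := (eventually_ge_atTop 1).mono hN
  have hp := EnergyWalk.eventually_survival_pos hN_lim hMN_lim
  refine ⟨?_, ?_⟩
  · filter_upwards [hN', hp] with M hM hpM using EnergyWalk.lifetime_ne_top hM hpM _
  · have hmeas : ∀ M, AEMeasurable (fun ζ : ℕ → EnergyWalk.State =>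
        4 * ((EnergyWalk.lifetime (N M) ζ).toNat : ℝ) / (N M : ℝ) ^ 2
          * Real.cos (Real.pi / (N M : ℝ)) ^ M) (EnergyWalk.law (N M) M (x M, y M)) :=
      fun M => (EnergyWalk.measurable_scaledLifetime (N M) M).aemeasurable
    refine ⟨hmeas, aemeasurable_id', ProbabilityMeasure.tendsto_iff_tendsto_charFun.2 fun t => ?_⟩
    have hlim : charFun ((expMeasure 1).map fun t : ℝ => t) t = 1 / (1 - t * Complex.I) := by
      rw [Measure.map_id', EnergyWalk.charFun_expMeasure_one]
    change Tendsto _ _ (nhds (charFun ((expMeasure 1).map fun t : ℝ => t) t))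
    rw [hlim]
    refine (EnergyWalk.tendsto_lifetimeGen hN_lim hMN_lim hx hy hy_lim t).congr' ?_
    filter_upwards [hN', hp] with M hM hpM
    exact (EnergyWalk.charFun_map_scaledLifetime hM hpM _ t).symm
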